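/- Let $n\in\mathbb{Z}_{+}$, $0<q<1$ and $r\in(0,+\infty]$. Let $\mathcal{O}_q^{\mathrm{reg}}(\mathbb{C}^n)$ be the unital $\mathbb{C}$-algebra generated by $x_1,\dots,x_n$ with relations $x_ix_j=q\,x_jx_i$ $(i<j)$, and let $\mathrm{Pol}_q(\mathbb{C}^n)$ be the unital $*$-algebra generated (as a $*$-algebra) by $x_1,\dots,x_n$ with relations $$x_ix_j=q\,x_jx_i\ (i<j),\qquad x_i^*x_j=q\,x_jx_i^*\ (i\neq j),\qquad x_i^*x_i=q^2x_ix_i^*+(1-q^2)\Bigl(1-\sum_{k>i}x_kx_k^*\Bigr).$$ For a number $p\ge 0$ and an integer $m\ge 0$ put $[m]_p=1+p+\dots+p^{m-1}$ and $[m]_p!=[1]_p\cdots[m]_p$ (so $[0]_p!=1$); for $k=(k_1,\dots,k_n)\in\mathbb{Z}_+^n$ put $|k|=k_1+\dots+k_n$, $[k]_p!=[k_1]_p!\cdots[k_n]_p!$ and $x^k=x_1^{k_1}\cdots x_n^{k_n}$. Let $H$ be the Hilbert space with orthonormal basis $\{e_k:k\in\mathbb{Z}_+^n\}$, let $\varepsilon_j$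 be the $j$-th standard basis vector of $\mathbb{Z}^n$, and let $\pi\colon\mathrm{Pol}_q(\mathbb{C}^n)\to\mathcal{B}(H)$ be the (Pusz–Woronowicz) Fock representation, i.e. the $*$-representation with $$\pi(x_j)e_k=\sqrt{1-q^2}\,\sqrt{[k_j+1]_{q^2}}\;q^{\sum_{i>j}k_i}\;e_{k+\varepsilon_j}.$$ For $\rho>0$ let $\gamma_\rho$ be the automorphism of $\mathcal{O}_q^{\mathrm{reg}}(\mathbb{C}^n)$ with $\gamma_\rho(x_i)=\rho x_i$, and for $a\in\mathcal{O}_q^{\mathrm{reg}}(\mathbb{C}^n)$ put $\|a\|_\rho^\infty=\|\pi(\gamma_\rho(a))\|$, where $\mathcal{O}_q^{\mathrm{reg}}(\mathbb{C}^n)$ is mapped to $\mathrm{Pol}_q(\mathbb{C}^n)$ by $x_i\mapsto x_i$. Finally, let $$\mathcal{O}_q(\mathbb{B}^n_r)=\Bigl\{a=\sum_{k\in\mathbb{Z}_+^n}c_kx^k:\ \|a\|_\rho=\sum_{k}|c_k|\Bigl(\frac{[k]_{q^{-2}}!}{[|k|]_{q^{-2}}!}\Bigr)^{1/2}\rho^{|k|}<\infty\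 \text{ for all }\rho\in(0,r)\Bigr\},$$ with the topology given by the norms $\|\cdot\|_\rho$ $(0<\rho<r)$ and the multiplication determined by $x_ix_j=q\,x_jx_i$ $(i<j)$. Then the completion of $\mathcal{O}_q^{\mathrm{reg}}(\mathbb{C}^n)$ with respect to the family of norms $\{\|\cdot\|_\rho^\infty:0<\rho<r\}$ is isomorphic, as a topological algebra, to $\mathcal{O}_q(\mathbb{B}^n_r)$, by an isomorphism that takes each $x_i$ to $x_i$. -/

import Mathlib

open scoped ENNReal

noncomputable section

namespace QuantumBall

/-! ### The algebraic quantum affine space -/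

/-- The relations `x_i x_j = q x_j x_i` for `i < j`. -/
inductive AffRel (n : ℕ) (q : ℂ) : FreeAlgebra ℂ (Fin n) → FreeAlgebra ℂ (Fin n) → Prop
  | comm (i j : Fin n) (h : i < j) :
      AffRel n q (FreeAlgebra.ι ℂ i * FreeAlgebra.ι ℂ j)
        (q • (FreeAlgebra.ι ℂ j * FreeAlgebra.ι ℂ i))

/-- The algebra of regular functions on the quantum affine `n`-space. -/
def Aff (n : ℕ) (q : ℂ) : Type := RingQuot (AffRel n q)

instance (n : ℕ) (q : ℂ) : Ring (Aff n q) := inferInstanceAs (Ring (RingQuot (AffRel n q)))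

instance (n : ℕ) (q : ℂ) : Algebra ℂ (Aff n q) :=
  inferInstanceAs (Algebra ℂ (RingQuot (AffRel n q)))

namespace Aff

variable {n : ℕ} {q : ℂ}

/-- The quotient homomorphism from the free algebra. -/
def mk : FreeAlgebra ℂ (Fin n) →ₐ[ℂ] Aff n q := RingQuot.mkAlgHom ℂ (AffRel n q)

theorem mk_rel {a b : FreeAlgebra ℂ (Fin n)} (h : AffRel n q a b) : (mk a : Aff n q) = mk b :=
  RingQuot.mkAlgHom_rel ℂ h

/-- The generators `x_1, …, x_n`. -/
def x (i : Fin n) : Aff n q := mk (FreeAlgebra.ι ℂ i)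

theorem x_mul_x {i j : Fin n} (h : i < j) :
    (x i * x j : Aff n q) = q • (x j * x i) := by
  have := mk_rel (AffRel.comm (q := q) i j h)
  simpa only [map_mul, map_smul, x] using this

/-- The homomorphism determined by images of the generators that satisfy the relations. -/
def lift {B : Type*} [Ring B] [Algebra ℂ B] (f : Fin n → B)
    (hf : ∀ i j, i < j → f i * f j = q • (f j * f i)) : Aff n q →ₐ[ℂ] B :=
  RingQuot.liftAlgHom ℂ ⟨FreeAlgebra.lift ℂ f, by
    rintro _ _ ⟨i, j, h⟩
    simpa only [map_mul, map_smul, FreeAlgebra.lift_ι_apply] using hf i j h⟩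

@[simp] theorem lift_x {B : Type*} [Ring B] [Algebra ℂ B] (f : Fin n → B)
    (hf : ∀ i j, i < j → f i * f j = q • (f j * f i)) (i : Fin n) : lift f hf (x i) = f i := by
  have := RingQuot.liftAlgHom_mkAlgHom_apply ℂ (FreeAlgebra.lift ℂ f) (s := AffRel n q) (by
    rintro _ _ ⟨i, j, h⟩
    simpa only [map_mul, map_smul, FreeAlgebra.lift_ι_apply] using hf i j h) (FreeAlgebra.ι ℂ i)
  rw [FreeAlgebra.lift_ι_apply] at this
  exact this

/-- The endomorphism `γ_ρ` with `γ_ρ (x_i) = ρ x_i`. -/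
def gamma (ρ : ℝ) : Aff n q →ₐ[ℂ] Aff n q :=
  lift (fun i => (ρ : ℂ) • x i) (by
    intro i j h
    simp only [smul_mul_assoc, mul_smul_comm, x_mul_x h]
    simp only [smul_smul]
    ring_nf)

end Aff

/-! ### The `*`-algebra `Pol_q(ℂⁿ)` -/

/-- The defining relations of `Pol_q(ℂⁿ)` on the generators `x_i` (`Sum.inl i`) and
`x_i^*` (`Sum.inr i`). The second constructor is the adjoint of the first; the families given by
the last two constructors are closed under taking adjoints. -/
inductive PolRel (n : ℕ) (q : Set.Ioo (0 : ℝ) 1) :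
    FreeAlgebra ℂ (Fin n ⊕ Fin n) → FreeAlgebra ℂ (Fin n ⊕ Fin n) → Prop
  | comm (i j : Fin n) (h : i < j) :
      PolRel n q (FreeAlgebra.ι ℂ (Sum.inl i) * FreeAlgebra.ι ℂ (Sum.inl j))
        (((q : ℝ) : ℂ) • (FreeAlgebra.ι ℂ (Sum.inl j) * FreeAlgebra.ι ℂ (Sum.inl i)))
  | comm_star (i j : Fin n) (h : i < j) :
      PolRel n q (FreeAlgebra.ι ℂ (Sum.inr j) * FreeAlgebra.ι ℂ (Sum.inr i))
        (((q : ℝ) : ℂ) • (FreeAlgebra.ι ℂ (Sum.inr i) * FreeAlgebra.ι ℂ (Sum.inr j)))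
  | star_comm (i j : Fin n) (h : i ≠ j) :
      PolRel n q (FreeAlgebra.ι ℂ (Sum.inr i) * FreeAlgebra.ι ℂ (Sum.inl j))
        (((q : ℝ) : ℂ) • (FreeAlgebra.ι ℂ (Sum.inl j) * FreeAlgebra.ι ℂ (Sum.inr i)))
  | star_self (i : Fin n) :
      PolRel n q (FreeAlgebra.ι ℂ (Sum.inr i) * FreeAlgebra.ι ℂ (Sum.inl i))
        ((((q : ℝ) : ℂ) ^ 2) • (FreeAlgebra.ι ℂ (Sum.inl i) * FreeAlgebra.ι ℂ (Sum.inr i))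
          + (1 - ((q : ℝ) : ℂ) ^ 2) • (1 - ∑ k ∈ Finset.Ioi i,
              FreeAlgebra.ι ℂ (Sum.inl k) * FreeAlgebra.ι ℂ (Sum.inr k)))

/-- The algebra `Pol_q(ℂⁿ)`; its involution is defined below. -/
def Pol (n : ℕ) (q : Set.Ioo (0 : ℝ) 1) : Type := RingQuot (PolRel n q)

instance (n : ℕ) (q : Set.Ioo (0 : ℝ) 1) : Ring (Pol n q) :=
  inferInstanceAs (Ring (RingQuot (PolRel n q)))

instance (n : ℕ) (q : Set.Ioo (0 : ℝ) 1) : Algebra ℂ (Pol n q) :=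
  inferInstanceAs (Algebra ℂ (RingQuot (PolRel n q)))

namespace Pol

variable {n : ℕ} {q : Set.Ioo (0 : ℝ) 1}

/-- The quotient homomorphism from the free algebra. -/
def mk : FreeAlgebra ℂ (Fin n ⊕ Fin n) →ₐ[ℂ] Pol n q := RingQuot.mkAlgHom ℂ (PolRel n q)

theorem mk_rel {a b : FreeAlgebra ℂ (Fin n ⊕ Fin n)} (h : PolRel n q a b) :
    (mk a : Pol n q) = mk b :=
  RingQuot.mkAlgHom_rel ℂ h

/-- The generators `x_i`. -/
def x (i : Fin n) : Pol n q := mk (FreeAlgebra.ι ℂ (Sum.inl i))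

/-- The generators `x_i^*`. -/
def y (i : Fin n) : Pol n q := mk (FreeAlgebra.ι ℂ (Sum.inr i))

/-- A pair of families in a complex algebra satisfies the defining relations. -/
structure Rels {B : Type*} [Ring B] [Algebra ℂ B] (q : Set.Ioo (0 : ℝ) 1)
    (f g : Fin n → B) : Prop where
  comm : ∀ i j, i < j → f i * f j = ((q : ℝ) : ℂ) • (f j * f i)
  comm_star : ∀ i j, i < j → g j * g i = ((q : ℝ) : ℂ) • (g i * g j)
  star_comm : ∀ i j, i ≠ j → g i * f j = ((q : ℝ) : ℂ) • (f j * g i)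
  star_self : ∀ i, g i * f i = (((q : ℝ) : ℂ) ^ 2) • (f i * g i)
    + (1 - ((q : ℝ) : ℂ) ^ 2) • (1 - ∑ k ∈ Finset.Ioi i, f k * g k)

theorem rels : Rels q (x : Fin n → Pol n q) y where
  comm i j h := by
    simpa only [map_mul, map_smul, x, y] using mk_rel (PolRel.comm (q := q) i j h)
  comm_star i j h := by
    simpa only [map_mul, map_smul, x, y] using mk_rel (PolRel.comm_star (q := q) i j h)
  star_comm i j h := by
    simpa only [map_mul, map_smul, x, y] using mk_rel (PolRel.star_comm (q := q) i j h)
  star_self i := by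
    simpa only [map_mul, map_smul, map_add, map_sub, map_one, map_sum, x, y] using
      mk_rel (PolRel.star_self (q := q) i)

theorem lift_aux {B : Type*} [Ring B] [Algebra ℂ B] {f g : Fin n → B} (h : Rels q f g)
    ⦃a b : FreeAlgebra ℂ (Fin n ⊕ Fin n)⦄ (hab : PolRel n q a b) :
    FreeAlgebra.lift ℂ (Sum.elim f g) a = FreeAlgebra.lift ℂ (Sum.elim f g) b := by
  rcases hab with ⟨i, j, hij⟩ | ⟨i, j, hij⟩ | ⟨i, j, hij⟩ | ⟨i⟩
  · simpa only [map_mul, map_smul, FreeAlgebra.lift_ι_apply, Sum.elim_inl, Sum.elim_inr] using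
      h.comm i j hij
  · simpa only [map_mul, map_smul, FreeAlgebra.lift_ι_apply, Sum.elim_inl, Sum.elim_inr] using
      h.comm_star i j hij
  · simpa only [map_mul, map_smul, FreeAlgebra.lift_ι_apply, Sum.elim_inl, Sum.elim_inr] using
      h.star_comm i j hij
  · simpa only [map_mul, map_smul, map_add, map_sub, map_one, map_sum, FreeAlgebra.lift_ι_apply,
      Sum.elim_inl, Sum.elim_inr] using h.star_self i

/-- The homomorphism determined by images of the generators that satisfy the relations. -/
def lift {B : Type*} [Ring B] [Algebra ℂ B] {f g : Fin n → B} (h : Rels q f g) :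
    Pol n q →ₐ[ℂ] B :=
  RingQuot.liftAlgHom ℂ ⟨FreeAlgebra.lift ℂ (Sum.elim f g), lift_aux h⟩

@[simp] theorem lift_x {B : Type*} [Ring B] [Algebra ℂ B] {f g : Fin n → B} (h : Rels q f g)
    (i : Fin n) : lift h (x i) = f i := by
  have := RingQuot.liftAlgHom_mkAlgHom_apply ℂ (FreeAlgebra.lift ℂ (Sum.elim f g)) (lift_aux h)
    (FreeAlgebra.ι ℂ (Sum.inl i))
  rw [FreeAlgebra.lift_ι_apply] at this
  exact this

@[simp] theorem lift_y {B : Type*} [Ring B] [Algebra ℂ B] {f g : Fin n → B} (h : Rels q f g)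
    (i : Fin n) : lift h (y i) = g i := by
  have := RingQuot.liftAlgHom_mkAlgHom_apply ℂ (FreeAlgebra.lift ℂ (Sum.elim f g)) (lift_aux h)
    (FreeAlgebra.ι ℂ (Sum.inr i))
  rw [FreeAlgebra.lift_ι_apply] at this
  exact this

theorem induction {C : Pol n q → Prop} (hs : ∀ c : ℂ, C (algebraMap ℂ _ c)) (hx : ∀ i, C (x i))
    (hy : ∀ i, C (y i)) (hm : ∀ a b, C a → C b → C (a * b)) (ha : ∀ a b, C a → C b → C (a + b))
    (a : Pol n q) : C a := by
  obtain ⟨a, rfl⟩ : ∃ b, mk b = a := RingQuot.mkAlgHom_surjective ℂ (PolRel n q) a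
  induction a using FreeAlgebra.induction with
  | grade0 c => rw [AlgHom.commutes]; exact hs c
  | grade1 i =>
    rcases i with i | i
    · exact hx i
    · exact hy i
  | mul a b h1 h2 => rw [map_mul]; exact hm _ _ h1 h2
  | add a b h1 h2 => rw [map_add]; exact ha _ _ h1 h2

/-- The opposite algebra with complex conjugate scalars: an algebra homomorphism into it is a
conjugate-linear anti-homomorphism. Used only to construct the involution. -/
def ConjOp (n : ℕ) (q : Set.Ioo (0 : ℝ) 1) : Type := (Pol n q)ᵐᵒᵖ

instance : Ring (ConjOp n q) := inferInstanceAs (Ring (Pol n q)ᵐᵒᵖ)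

instance : Algebra ℂ (ConjOp n q) :=
  ((algebraMap ℂ (Pol n q)ᵐᵒᵖ).comp (starRingEnd ℂ)).toAlgebra'
    (fun c a => Algebra.commutes (A := (Pol n q)ᵐᵒᵖ) (starRingEnd ℂ c) a)

/-- The identity map, as a map from `Pol_q(ℂⁿ)` to the conjugate opposite algebra. -/
def toConj (a : Pol n q) : ConjOp n q := (MulOpposite.op a : (Pol n q)ᵐᵒᵖ)

theorem toConj_mul (a b : Pol n q) : toConj (a * b) = toConj b * toConj a := rfl

theorem toConj_add (a b : Pol n q) : toConj (a + b) = toConj a + toConj b := rfl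

theorem toConj_sub (a b : Pol n q) : toConj (a - b) = toConj a - toConj b := rfl

theorem toConj_one : toConj (1 : Pol n q) = 1 := rfl

theorem toConj_sum (s : Finset (Fin n)) (f : Fin n → Pol n q) :
    toConj (∑ i ∈ s, f i) = ∑ i ∈ s, toConj (f i) :=
  map_sum (AddMonoidHom.mk' (toConj : Pol n q → ConjOp n q) toConj_add) f s

theorem toConj_smul (c : ℂ) (a : Pol n q) : toConj (c • a) = starRingEnd ℂ c • toConj a := by
  rw [Algebra.smul_def, Algebra.smul_def, toConj_mul]
  refine (Algebra.commutes (A := ConjOp n q) (starRingEnd ℂ c) (toConj a) ▸ ?_)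
  refine congrArg (toConj a * ·) ?_
  change _ = toConj (algebraMap ℂ (Pol n q) (starRingEnd ℂ (starRingEnd ℂ c)))
  rw [Complex.conj_conj]

theorem conjOp_rels : Rels q (fun i : Fin n => (toConj (y i) : ConjOp n q))
    (fun i => toConj (x i)) where
  comm i j h := by
    have := congrArg toConj ((rels (q := q)).comm_star i j h)
    simpa only [toConj_mul, toConj_smul, Complex.conj_ofReal] using this
  comm_star i j h := by
    have := congrArg toConj ((rels (q := q)).comm i j h)
    simpa only [toConj_mul, toConj_smul, Complex.conj_ofReal] using this
  star_comm i j h := by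
    have := congrArg toConj ((rels (q := q)).star_comm j i h.symm)
    simpa only [toConj_mul, toConj_smul, Complex.conj_ofReal] using this
  star_self i := by
    have := congrArg toConj ((rels (q := q)).star_self i)
    simpa only [toConj_mul, toConj_smul, toConj_add, toConj_sub, toConj_one, toConj_sum,
      Complex.conj_ofReal, map_sub, map_one, map_pow] using this

/-- The involution as a homomorphism into the conjugate opposite algebra. -/
def starHom : Pol n q →ₐ[ℂ] ConjOp n q := lift conjOp_rels

instance : Star (Pol n q) := ⟨fun a => MulOpposite.unop (starHom a : (Pol n q)ᵐᵒᵖ)⟩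

theorem star_def (a : Pol n q) : star a = MulOpposite.unop (starHom a : (Pol n q)ᵐᵒᵖ) := rfl

@[simp] theorem star_x (i : Fin n) : star (x i : Pol n q) = y i :=
  congrArg MulOpposite.unop (lift_x conjOp_rels i)

@[simp] theorem star_y (i : Fin n) : star (y i : Pol n q) = x i :=
  congrArg MulOpposite.unop (lift_y conjOp_rels i)

theorem star_algebraMap' (c : ℂ) :
    star (algebraMap ℂ (Pol n q) c) = algebraMap ℂ (Pol n q) (star c) :=
  congrArg MulOpposite.unop (AlgHom.commutes starHom c)

theorem star_mul' (a b : Pol n q) : star (a * b) = star b * star a :=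
  congrArg MulOpposite.unop (map_mul starHom a b)

theorem star_add' (a b : Pol n q) : star (a + b) = star a + star b :=
  congrArg MulOpposite.unop (map_add starHom a b)

instance : StarRing (Pol n q) where
  star_involutive a := by
    induction a using induction with
    | hs c => simp [star_algebraMap']
    | hx i => simp
    | hy i => simp
    | hm a b h1 h2 => rw [star_mul', star_mul', h1, h2]
    | ha a b h1 h2 => rw [star_add', star_add', h1, h2]
  star_mul := star_mul'
  star_add := star_add'

instance : StarModule ℂ (Pol n q) where
  star_smul c a := by
    rw [Algebra.smul_def, star_mul', star_algebraMap', ← Algebra.commutes, ← Algebra.smul_def]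

/-- The canonical homomorphism from the quantum affine space to `Pol_q(ℂⁿ)`, `x_i ↦ x_i`. -/
def ofAff : Aff n ((q : ℝ) : ℂ) →ₐ[ℂ] Pol n q := Aff.lift x rels.comm

end Pol

/-! ### `q`-numbers -/

/-- `[k]_p = 1 + p + ⋯ + p^(k-1)`. -/
def qNum (p : ℝ) (k : ℕ) : ℝ := ∑ i ∈ Finset.range k, p ^ i

/-- `[k]_p! = [1]_p [2]_p ⋯ [k]_p`. -/
def qFact (p : ℝ) (k : ℕ) : ℝ := ∏ i ∈ Finset.range k, qNum p (i + 1)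

/-! ### The Fock representation -/

/-- The Hilbert space with orthonormal basis `e_k`, `k ∈ ℤ₊ⁿ`. -/
abbrev Fock (n : ℕ) : Type := lp (fun _ : Fin n →₀ ℕ => ℂ) 2

namespace Fock

variable {n : ℕ} (q : Set.Ioo (0 : ℝ) 1)

/-- The basis vector `e_k`. -/
def e (k : Fin n →₀ ℕ) : Fock n := lp.single 2 k (1 : ℂ)

/-- The coefficient `√(1 - q²) √[k_j + 1]_{q²} q^(∑_{i > j} k_i)`. -/
def coef (j : Fin n) (k : Fin n →₀ ℕ) : ℝ :=
  √(1 - (q : ℝ) ^ 2) * √(qNum ((q : ℝ) ^ 2) (k j + 1)) * (q : ℝ) ^ (∑ i ∈ Finset.Ioi j, k i)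

theorem coef_nonneg (j : Fin n) (k : Fin n →₀ ℕ) : 0 ≤ coef q j k := by
  have := q.2.1
  unfold coef
  positivity

theorem coef_sq (j : Fin n) (k : Fin n →₀ ℕ) : coef q j k ^ 2 =
    (1 - ((q : ℝ) ^ 2) ^ (k j + 1)) * ((q : ℝ) ^ 2) ^ (∑ i ∈ Finset.Ioi j, k i) := by
  have h0 := q.2.1
  have h1 := q.2.2
  have h2 : 0 ≤ 1 - (q : ℝ) ^ 2 := by nlinarith
  have h3 : 0 ≤ qNum ((q : ℝ) ^ 2) (k j + 1) := by unfold qNum; positivity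
  rw [coef, mul_pow, mul_pow, Real.sq_sqrt h2, Real.sq_sqrt h3, ← pow_mul, ← pow_mul,
    mul_comm _ 2, pow_mul (q : ℝ) 2]
  congr 1
  rw [qNum, mul_neg_geom_sum]
  ring

theorem coef_le_one (j : Fin n) (k : Fin n →₀ ℕ) : coef q j k ≤ 1 := by
  have h0 := q.2.1
  have h1 := q.2.2
  have h2 : (q : ℝ) ^ 2 ≤ 1 := by nlinarith
  have h3 : 0 ≤ ((q : ℝ) ^ 2) ^ (k j + 1) := by positivity
  have h4 : ((q : ℝ) ^ 2) ^ (k j + 1) ≤ 1 := pow_le_one₀ (by positivity) h2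
  have h5 : ((q : ℝ) ^ 2) ^ (∑ i ∈ Finset.Ioi j, k i) ≤ 1 := pow_le_one₀ (by positivity) h2
  have h6 : coef q j k ^ 2 ≤ 1 := by
    rw [coef_sq]
    exact mul_le_one₀ (by linarith) (by positivity) h5
  nlinarith [coef_nonneg q j k]

/-- The coordinates of the weighted shift `e_k ↦ coef j k • e_(k + ε_j)`. -/
def shiftFun (j : Fin n) (f : (Fin n →₀ ℕ) → ℂ) (m : Fin n →₀ ℕ) : ℂ :=
  if m j = 0 then 0
  else (coef q j (m - Finsupp.single j 1) : ℂ) * f (m - Finsupp.single j 1)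

theorem shiftFun_add (j : Fin n) (f : (Fin n →₀ ℕ) → ℂ) (m : Fin n →₀ ℕ) :
    shiftFun q j f (m + Finsupp.single j 1) = (coef q j m : ℂ) * f m := by
  simp [shiftFun]

theorem exists_add {j : Fin n} {m : Fin n →₀ ℕ} (h : m j ≠ 0) :
    ∃ m', m = m' + Finsupp.single j 1 :=
  ⟨m - Finsupp.single j 1, (tsub_add_cancel_of_le (by
    rw [Finsupp.single_le_iff]; omega)).symm⟩

theorem shift_injective (j : Fin n) :
    Function.Injective (fun m : Fin n →₀ ℕ => m + Finsupp.single j 1) :=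
  add_left_injective _

theorem shiftFun_support (j : Fin n) (f : (Fin n →₀ ℕ) → ℂ) (m : Fin n →₀ ℕ)
    (hm : m ∉ Set.range (fun m : Fin n →₀ ℕ => m + Finsupp.single j 1)) :
    ‖shiftFun q j f m‖ ^ 2 = 0 := by
  by_cases h : m j = 0
  · simp [shiftFun, h]
  · obtain ⟨m', rfl⟩ := exists_add h
    exact (hm ⟨m', rfl⟩).elim

theorem norm_shiftFun_le (j : Fin n) (f : (Fin n →₀ ℕ) → ℂ) (m : Fin n →₀ ℕ) :
    ‖shiftFun q j f (m + Finsupp.single j 1)‖ ^ 2 ≤ ‖f m‖ ^ 2 := by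
  rw [shiftFun_add, norm_mul, Complex.norm_real, Real.norm_of_nonneg (coef_nonneg q j m)]
  exact pow_le_pow_left₀ (mul_nonneg (coef_nonneg q j m) (norm_nonneg _))
    (mul_le_of_le_one_left (norm_nonneg (f m)) (coef_le_one q j m)) 2

theorem summable_sq (f : Fock n) : Summable fun m => ‖f m‖ ^ 2 := by
  have := (memℓp_gen_iff (p := 2) (by norm_num)).1 (lp.memℓp f)
  simpa using this

theorem norm_sq (f : Fock n) : ‖f‖ ^ 2 = ∑' m, ‖f m‖ ^ 2 := by
  have := lp.norm_rpow_eq_tsum (by norm_num) f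
  simpa using this

theorem summable_shift (j : Fin n) (f : Fock n) :
    Summable fun m => ‖shiftFun q j f m‖ ^ 2 := by
  rw [← (shift_injective j).summable_iff (shiftFun_support q j f)]
  exact Summable.of_nonneg_of_le (fun _ => sq_nonneg _) (fun m => norm_shiftFun_le q j f m)
    (summable_sq f)

/-- The operator `e_k ↦ √(1 - q²) √[k_j + 1]_{q²} q^(∑_{i > j} k_i) e_(k + ε_j)`. -/
def creation (j : Fin n) : Fock n →L[ℂ] Fock n :=
  LinearMap.mkContinuous
    { toFun := fun f => ⟨shiftFun q j f, memℓp_gen (by simpa using summable_shift q j f)⟩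
      map_add' := by
        intro f g
        ext m
        simp only [shiftFun, lp.coeFn_add, Pi.add_apply]
        split_ifs <;> ring
      map_smul' := by
        intro c f
        ext m
        simp only [shiftFun, lp.coeFn_smul, Pi.smul_apply, smul_eq_mul, RingHom.id_apply]
        split_ifs <;> ring } 1 (by
    intro f
    rw [one_mul]
    refine (sq_le_sq₀ (norm_nonneg _) (norm_nonneg _)).1 ?_
    rw [norm_sq, norm_sq]
    change ∑' m, ‖shiftFun q j f m‖ ^ 2 ≤ _
    rw [← (shift_injective j).tsum_eq (f := fun m => ‖shiftFun q j f m‖ ^ 2)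
      (fun m hm => by
        by_contra h
        exact hm (shiftFun_support q j f m h))]
    exact Summable.tsum_le_tsum (fun m => norm_shiftFun_le q j f m)
      ((shift_injective j).summable_iff (shiftFun_support q j f) |>.2 (summable_shift q j f))
      (summable_sq f))

theorem creation_apply (j : Fin n) (f : Fock n) (m : Fin n →₀ ℕ) :
    creation q j f m = shiftFun q j f m := rfl

theorem creation_apply_add (j : Fin n) (f : Fock n) (m : Fin n →₀ ℕ) :
    creation q j f (m + Finsupp.single j 1) = (coef q j m : ℂ) * f m := shiftFun_add q j f m

theorem creation_apply_zero (j : Fin n) (f : Fock n) (m : Fin n →₀ ℕ) (h : m j = 0) :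
    creation q j f m = 0 := by simp [creation_apply, shiftFun, h]

/-- The action of the operators on basis vectors. -/
theorem creation_e (j : Fin n) (k : Fin n →₀ ℕ) :
    creation q j (e k) = (coef q j k : ℂ) • e (k + Finsupp.single j 1) := by
  ext m
  rw [show ((coef q j k : ℂ) • e (k + Finsupp.single j 1) : Fock n) m
    = (coef q j k : ℂ) * e (k + Finsupp.single j 1) m from rfl]
  by_cases h : m j = 0
  · rw [creation_apply_zero q j _ m h]
    have : m ≠ k + Finsupp.single j 1 := by rintro rfl; simp at h
    simp [e, Pi.single_eq_of_ne this]
  · obtain ⟨m, rfl⟩ := exists_add h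
    rw [creation_apply_add]
    by_cases hm : m = k
    · subst hm; simp [e]
    · have : m + Finsupp.single j 1 ≠ k + Finsupp.single j 1 := fun h => hm (by simpa using h)
      simp [e, Pi.single_eq_of_ne hm, Pi.single_eq_of_ne this]

theorem adjoint_apply (j : Fin n) (f : Fock n) (m : Fin n →₀ ℕ) :
    star (creation q j) f m = (coef q j m : ℂ) * f (m + Finsupp.single j 1) := by
  have key : ∀ (g : Fock n) (k : Fin n →₀ ℕ), g k = inner ℂ (e k) g := by
    intro g k
    simp [e, lp.inner_single_left]
  rw [ContinuousLinearMap.star_eq_adjoint, key, ContinuousLinearMap.adjoint_inner_right,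
    creation_e, inner_smul_left, ← key, Complex.conj_ofReal]

theorem telescope (p : ℝ) (k : Fin n →₀ ℕ) (s : Finset (Fin n)) :
    ∑ i ∈ s, (1 - p ^ k i) * p ^ (∑ l ∈ s with i < l, k l) = 1 - p ^ (∑ l ∈ s, k l) := by
  induction s using Finset.induction_on_min with
  | empty => simp
  | insert a s ha ih =>
    have hns : a ∉ s := fun h => lt_irrefl _ (ha a h)
    rw [Finset.sum_insert hns, Finset.sum_insert hns, Finset.filter_insert, if_neg (lt_irrefl a),
      Finset.filter_true_of_mem ha, pow_add]
    rw [Finset.sum_congr rfl (g := fun i => (1 - p ^ k i) * p ^ (∑ l ∈ s with i < l, k l)), ih]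
    · ring
    · intro i hi
      rw [Finset.filter_insert, if_neg (not_lt.2 (ha i hi).le)]

theorem telescope_Ioi (p : ℝ) (k : Fin n →₀ ℕ) (i : Fin n) :
    ∑ j ∈ Finset.Ioi i, (1 - p ^ k j) * p ^ (∑ l ∈ Finset.Ioi j, k l)
      = 1 - p ^ (∑ l ∈ Finset.Ioi i, k l) := by
  rw [← telescope p k (Finset.Ioi i)]
  refine Finset.sum_congr rfl fun j hj => ?_
  congr 3
  ext l
  simp only [Finset.mem_Ioi, Finset.mem_filter] at hj ⊢
  exact ⟨fun h => ⟨hj.trans h, h⟩, fun h => h.2⟩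

theorem sum_Ioi_single (i j : Fin n) :
    ∑ l ∈ Finset.Ioi i, (Finsupp.single j 1 : Fin n →₀ ℕ) l = if i < j then 1 else 0 := by
  simp [Finsupp.single_apply, Finset.sum_ite_eq]

theorem coef_add_of_ne {i j : Fin n} (h : i ≠ j) (m : Fin n →₀ ℕ) :
    coef q i (m + Finsupp.single j 1) = coef q i m * (if i < j then (q : ℝ) else 1) := by
  have h1 : (Finsupp.single j 1 : Fin n →₀ ℕ) i = 0 := Finsupp.single_eq_of_ne h
  simp only [coef, Finsupp.add_apply, Finset.sum_add_distrib, sum_Ioi_single, h1, add_zero,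
    pow_add]
  split_ifs <;> ring

theorem creation_adjoint_apply (i : Fin n) (f : Fock n) (m : Fin n →₀ ℕ) :
    creation q i (star (creation q i) f) m =
      (((1 - ((q : ℝ) ^ 2) ^ m i) * ((q : ℝ) ^ 2) ^ (∑ l ∈ Finset.Ioi i, m l) : ℝ) : ℂ) * f m := by
  by_cases h : m i = 0
  · rw [creation_apply_zero q i _ m h, h]; simp
  · obtain ⟨m, rfl⟩ := exists_add h
    rw [creation_apply_add, adjoint_apply, ← mul_assoc, ← Complex.ofReal_mul, ← sq, coef_sq]
    simp only [Finsupp.add_apply, Finset.sum_add_distrib, sum_Ioi_single, lt_irrefl, if_false,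
      Finsupp.single_eq_same, add_zero]

theorem creation_comm {i j : Fin n} (h : i < j) :
    creation q i * creation q j = ((q : ℝ) : ℂ) • (creation q j * creation q i) := by
  ext f m
  change creation q i (creation q j f) m = ((q : ℝ) : ℂ) * creation q j (creation q i f) m
  by_cases hi : m i = 0
  · rw [creation_apply_zero q i _ m hi]
    by_cases hj : m j = 0
    · rw [creation_apply_zero q j _ m hj, mul_zero]
    · obtain ⟨m, rfl⟩ := exists_add hj
      rw [creation_apply_add, creation_apply_zero q i, mul_zero, mul_zero]
      simpa using (show m i = 0 by simpa [h.ne'] using hi)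
  · obtain ⟨m, rfl⟩ := exists_add hi
    rw [creation_apply_add]
    by_cases hj : m j = 0
    · rw [creation_apply_zero q j _ m hj, creation_apply_zero q j, mul_zero, mul_zero]
      simpa [h.ne] using hj
    · obtain ⟨m, rfl⟩ := exists_add hj
      rw [creation_apply_add, add_right_comm, creation_apply_add, creation_apply_add,
        coef_add_of_ne q h.ne, coef_add_of_ne q h.ne', if_pos h, if_neg h.not_gt]
      push_cast
      ring

theorem adjoint_creation {i j : Fin n} (h : i ≠ j) :
    star (creation q i) * creation q j
      = ((q : ℝ) : ℂ) • (creation q j * star (creation q i)) := by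
  ext f m
  change star (creation q i) (creation q j f) m
    = ((q : ℝ) : ℂ) * creation q j (star (creation q i) f) m
  rw [adjoint_apply]
  by_cases hj : m j = 0
  · rw [creation_apply_zero q j _ m hj, creation_apply_zero q j, mul_zero, mul_zero]
    simpa [h] using hj
  · obtain ⟨m, rfl⟩ := exists_add hj
    rw [add_right_comm, creation_apply_add, creation_apply_add, adjoint_apply,
      coef_add_of_ne q h, coef_add_of_ne q h.symm]
    rcases lt_or_gt_of_ne h with h | h
    · rw [if_pos h, if_neg h.not_gt]; push_cast; ring
    · rw [if_pos h, if_neg h.not_gt]; push_cast; ring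

theorem adjoint_creation_self (i : Fin n) :
    star (creation q i) * creation q i
      = (((q : ℝ) : ℂ) ^ 2) • (creation q i * star (creation q i))
        + (1 - ((q : ℝ) : ℂ) ^ 2) • (1 - ∑ k ∈ Finset.Ioi i,
            creation q k * star (creation q k)) := by
  ext f m
  have hsum : ((∑ k ∈ Finset.Ioi i, creation q k * star (creation q k)) f) m
      = ((1 - ((q : ℝ) ^ 2) ^ (∑ l ∈ Finset.Ioi i, m l) : ℝ) : ℂ) * f m := by
    rw [← telescope_Ioi, Complex.ofReal_sum, Finset.sum_mul]
    rw [sum_apply, lp.coeFn_sum, Finset.sum_apply]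
    exact Finset.sum_congr rfl fun k _ => creation_adjoint_apply q k f m
  change star (creation q i) (creation q i f) m
    = ((q : ℝ) : ℂ) ^ 2 * creation q i (star (creation q i) f) m
      + (1 - ((q : ℝ) : ℂ) ^ 2) * (f m -
        ((∑ k ∈ Finset.Ioi i, creation q k * star (creation q k)) f) m)
  rw [hsum, creation_adjoint_apply, adjoint_apply, creation_apply_add, ← mul_assoc,
    ← Complex.ofReal_mul, ← sq, coef_sq]
  push_cast
  ring

theorem rels : Pol.Rels q (creation q : Fin n → Fock n →L[ℂ] Fock n)
    (fun i => star (creation q i)) where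
  comm _ _ h := creation_comm q h
  comm_star i j h := by
    have := congrArg star (creation_comm q h)
    simpa only [star_mul, star_smul, RCLike.star_def, Complex.conj_ofReal] using this
  star_comm _ _ h := adjoint_creation q h
  star_self i := adjoint_creation_self q i

/-- The Fock representation `π : Pol_q(ℂⁿ) → B(H)`, the `*`-representation with
`π(x_j) e_k = √(1 - q²) √[k_j + 1]_{q²} q^(∑_{i > j} k_i) e_(k + ε_j)`. -/
def rep : Pol n q →⋆ₐ[ℂ] (Fock n →L[ℂ] Fock n) where
  toAlgHom := Pol.lift (rels q)
  map_star' a := by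
    change Pol.lift (rels q) (star a) = star (Pol.lift (rels q) a)
    induction a using Pol.induction with
    | hs c => rw [Pol.star_algebraMap', AlgHom.commutes, AlgHom.commutes, algebraMap_star_comm]
    | hx i => simp
    | hy i => simp
    | hm a b h1 h2 => rw [Pol.star_mul', map_mul, map_mul, star_mul, h1, h2]
    | ha a b h1 h2 => rw [Pol.star_add', map_add, map_add, star_add, h1, h2]

theorem rep_x_e (j : Fin n) (k : Fin n →₀ ℕ) :
    rep q (Pol.x j) (e k) = ((√(1 - (q : ℝ) ^ 2) * √(qNum ((q : ℝ) ^ 2) (k j + 1)) *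
      (q : ℝ) ^ (∑ i ∈ Finset.Ioi j, k i) : ℝ) : ℂ) • e (k + Finsupp.single j 1) := by
  have : rep q (Pol.x j) = creation q j := Pol.lift_x (rels q) j
  rw [this]
  exact creation_e q j k

end Fock

/-! ### The twisted algebra of formal power series -/

/-- Formal power series `∑ c_k x^k`, `k ∈ ℤ₊ⁿ`, `x^k = x_1^(k_1) ⋯ x_n^(k_n)`, multiplied
according to `x_i x_j = q x_j x_i` (`i < j`). -/
def QSeries (n : ℕ) (_q : ℂ) : Type := (Fin n →₀ ℕ) → ℂ

/-- The exponent in `x^k x^l = q^(-twist k l) x^(k + l)`. -/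
def twist {n : ℕ} (k l : Fin n →₀ ℕ) : ℕ := ∑ i, ∑ j ∈ Finset.Ioi i, k j * l i

theorem twist_add_left {n : ℕ} (k k' l : Fin n →₀ ℕ) :
    twist (k + k') l = twist k l + twist k' l := by
  simp [twist, add_mul, Finset.sum_add_distrib]

theorem twist_add_right {n : ℕ} (k l l' : Fin n →₀ ℕ) :
    twist k (l + l') = twist k l + twist k l' := by
  simp [twist, mul_add, Finset.sum_add_distrib]

@[simp] theorem twist_zero_left {n : ℕ} (l : Fin n →₀ ℕ) : twist 0 l = 0 := by simp [twist]

@[simp] theorem twist_zero_right {n : ℕ} (l : Fin n →₀ ℕ) : twist l 0 = 0 := by simp [twist]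

namespace QSeries

variable {n : ℕ} {q : ℂ}

instance : AddCommGroup (QSeries n q) := inferInstanceAs (AddCommGroup ((Fin n →₀ ℕ) → ℂ))

instance : Module ℂ (QSeries n q) := inferInstanceAs (Module ℂ ((Fin n →₀ ℕ) → ℂ))

/-- The coefficient of `x^k`. -/
def coeff (a : QSeries n q) (k : Fin n →₀ ℕ) : ℂ := a k

@[ext] theorem ext {a b : QSeries n q} (h : ∀ k, a.coeff k = b.coeff k) : a = b := funext h

/-- The series `c x^k`. -/
def monomial (k : Fin n →₀ ℕ) (c : ℂ) : QSeries n q := Pi.single k c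

instance : One (QSeries n q) := ⟨monomial 0 1⟩

instance : Mul (QSeries n q) :=
  ⟨fun a b m => ∑ kl ∈ Finset.HasAntidiagonal.antidiagonal m, q⁻¹ ^ twist kl.1 kl.2 * (a kl.1 * b kl.2)⟩

@[simp] theorem coeff_zero (k : Fin n →₀ ℕ) : (0 : QSeries n q).coeff k = 0 := rfl

@[simp] theorem coeff_add (a b : QSeries n q) (k : Fin n →₀ ℕ) :
    (a + b).coeff k = a.coeff k + b.coeff k := rfl

@[simp] theorem coeff_smul (c : ℂ) (a : QSeries n q) (k : Fin n →₀ ℕ) :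
    (c • a).coeff k = c * a.coeff k := rfl

theorem coeff_monomial (k l : Fin n →₀ ℕ) (c : ℂ) :
    (monomial k c : QSeries n q).coeff l = if l = k then c else 0 := by
  simp [monomial, coeff, Pi.single_apply]

theorem coeff_one (l : Fin n →₀ ℕ) : (1 : QSeries n q).coeff l = if l = 0 then 1 else 0 :=
  coeff_monomial 0 l 1

theorem coeff_mul (a b : QSeries n q) (m : Fin n →₀ ℕ) :
    (a * b).coeff m = ∑ kl ∈ Finset.HasAntidiagonal.antidiagonal m,
      q⁻¹ ^ twist kl.1 kl.2 * (a.coeff kl.1 * b.coeff kl.2) := rfl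

theorem monomial_mul (k l : Fin n →₀ ℕ) (c d : ℂ) :
    (monomial k c * monomial l d : QSeries n q) = monomial (k + l) (q⁻¹ ^ twist k l * (c * d)) := by
  ext m
  rw [coeff_mul, coeff_monomial]
  simp only [coeff_monomial]
  split_ifs with h
  · subst h
    rw [Finset.sum_eq_single (k, l)]
    · simp
    · rintro ⟨a, b⟩ _ hne
      by_cases h1 : a = k
      · have : b ≠ l := fun h2 => hne (by rw [h1, h2])
        simp [this]
      · simp [h1]
    · intro h; simp at h
  · refine Finset.sum_eq_zero ?_
    rintro ⟨a, b⟩ hab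
    rw [Finset.HasAntidiagonal.mem_antidiagonal] at hab
    by_cases h1 : a = k
    · have : b ≠ l := fun h2 => h (by rw [← hab, h1, h2])
      simp [this]
    · simp [h1]

theorem one_mul' (a : QSeries n q) : 1 * a = a := by
  ext m
  rw [coeff_mul, Finset.sum_eq_single (0, m)]
  · simp [coeff_one]
  · rintro ⟨k, l⟩ hkl hne
    rw [Finset.HasAntidiagonal.mem_antidiagonal] at hkl
    have : k ≠ 0 := by rintro rfl; exact hne (by simpa using hkl)
    simp [coeff_one, this]
  · intro h; simp at h

theorem mul_one' (a : QSeries n q) : a * 1 = a := by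
  ext m
  rw [coeff_mul, Finset.sum_eq_single (m, 0)]
  · simp [coeff_one]
  · rintro ⟨k, l⟩ hkl hne
    rw [Finset.HasAntidiagonal.mem_antidiagonal] at hkl
    have : l ≠ 0 := by rintro rfl; exact hne (by simpa using hkl)
    simp [coeff_one, this]
  · intro h; simp at h

theorem mul_assoc' (a b c : QSeries n q) : a * b * c = a * (b * c) := by
  ext m
  simp only [coeff_mul, Finset.sum_mul, Finset.mul_sum, Finset.sum_sigma']
  refine Finset.sum_nbij' (fun s => ⟨(s.2.1, s.2.2 + s.1.2), (s.2.2, s.1.2)⟩)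
    (fun s => ⟨(s.1.1 + s.2.1, s.2.2), (s.1.1, s.2.1)⟩) ?_ ?_ ?_ ?_ ?_
  · rintro ⟨⟨i, j⟩, ⟨k, l⟩⟩ h
    simp only [Finset.mem_sigma, Finset.HasAntidiagonal.mem_antidiagonal] at h ⊢
    obtain ⟨h1, h2⟩ := h
    exact ⟨by rw [← h1, ← h2, add_assoc], trivial⟩
  · rintro ⟨⟨i, j⟩, ⟨k, l⟩⟩ h
    simp only [Finset.mem_sigma, Finset.HasAntidiagonal.mem_antidiagonal] at h ⊢
    obtain ⟨h1, h2⟩ := h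
    exact ⟨by rw [← h1, ← h2, add_assoc], trivial⟩
  · rintro ⟨⟨i, j⟩, ⟨k, l⟩⟩ h
    simp only [Finset.mem_sigma, Finset.HasAntidiagonal.mem_antidiagonal] at h
    obtain ⟨h1, rfl⟩ := h
    rfl
  · rintro ⟨⟨i, j⟩, ⟨k, l⟩⟩ h
    simp only [Finset.mem_sigma, Finset.HasAntidiagonal.mem_antidiagonal] at h
    obtain ⟨h1, rfl⟩ := h
    rfl
  · rintro ⟨⟨i, j⟩, ⟨k, l⟩⟩ h
    simp only [Finset.mem_sigma, Finset.HasAntidiagonal.mem_antidiagonal] at h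
    obtain ⟨h1, rfl⟩ := h
    simp only [twist_add_left, twist_add_right, pow_add]
    ring

instance : Ring (QSeries n q) :=
  { (inferInstance : AddCommGroup (QSeries n q)) with
    mul := (· * ·)
    one := 1
    one_mul := one_mul'
    mul_one := mul_one'
    mul_assoc := mul_assoc'
    zero_mul := fun a => by ext m; simp [coeff_mul]
    mul_zero := fun a => by ext m; simp [coeff_mul]
    left_distrib := fun a b c => by
      ext m; simp [coeff_mul, mul_add, Finset.sum_add_distrib]
    right_distrib := fun a b c => by
      ext m; simp [coeff_mul, mul_add, add_mul, Finset.sum_add_distrib] }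

instance : Algebra ℂ (QSeries n q) :=
  Algebra.ofModule
    (fun c a b => by
      ext m
      simp only [coeff_mul, coeff_smul, Finset.mul_sum]
      exact Finset.sum_congr rfl fun _ _ => by ring)
    (fun c a b => by
      ext m
      simp only [coeff_mul, coeff_smul, Finset.mul_sum]
      exact Finset.sum_congr rfl fun _ _ => by ring)

/-- The element `x_i`. -/
def x (i : Fin n) : QSeries n q := monomial (Finsupp.single i 1) 1

theorem twist_single (i j : Fin n) :
    twist (Finsupp.single i 1) (Finsupp.single j 1) = if j < i then 1 else 0 := by
  simp [twist, Finsupp.single_apply]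

theorem x_mul_x (hq : q ≠ 0) {i j : Fin n} (h : i < j) :
    (x i * x j : QSeries n q) = q • (x j * x i) := by
  ext m
  rw [coeff_smul, x, x, monomial_mul, monomial_mul, coeff_monomial, coeff_monomial, twist_single,
    twist_single, if_neg h.not_gt, if_pos h, add_comm (Finsupp.single j 1)]
  split_ifs <;> simp [hq]

end QSeries

/-! ### The algebra of holomorphic functions on the quantum ball -/

theorem qNum_pos {p : ℝ} (hp : 0 ≤ p) (k : ℕ) : 0 < qNum p (k + 1) := by
  rw [qNum, Finset.sum_range_succ']
  positivity

theorem qFact_pos {p : ℝ} (hp : 0 ≤ p) (k : ℕ) : 0 < qFact p k :=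
  Finset.prod_pos fun _ _ => qNum_pos hp _

theorem qFact_succ (p : ℝ) (k : ℕ) : qFact p (k + 1) = qFact p k * qNum p (k + 1) :=
  Finset.prod_range_succ _ _

/-- The `q`-binomial coefficient, as a function of the two lower indices. -/
def qBinom (p : ℝ) (a b : ℕ) : ℝ := qFact p (a + b) / (qFact p a * qFact p b)

theorem qBinom_pos {p : ℝ} (hp : 0 ≤ p) (a b : ℕ) : 0 < qBinom p a b :=
  div_pos (qFact_pos hp _) (mul_pos (qFact_pos hp _) (qFact_pos hp _))

theorem qBinom_zero_left {p : ℝ} (hp : 0 ≤ p) (b : ℕ) : qBinom p 0 b = 1 := by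
  have := (qFact_pos hp b).ne'
  rw [qBinom, zero_add, show qFact p 0 = 1 by simp [qFact], one_mul, div_self this]

theorem qBinom_zero_right {p : ℝ} (hp : 0 ≤ p) (b : ℕ) : qBinom p b 0 = 1 := by
  have := (qFact_pos hp b).ne'
  rw [qBinom, add_zero, show qFact p 0 = 1 by simp [qFact], mul_one, div_self this]

theorem qBinom_succ {p : ℝ} (hp : 0 ≤ p) (a b : ℕ) :
    qBinom p (a + 1) (b + 1) = p ^ (b + 1) * qBinom p a (b + 1) + qBinom p (a + 1) b := by
  have ha := (qFact_pos hp a).ne'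
  have hb := (qFact_pos hp b).ne'
  have ha' := (qNum_pos hp a).ne'
  have hb' := (qNum_pos hp b).ne'
  have key : qNum p (a + b + 1 + 1) = qNum p (b + 1) + p ^ (b + 1) * qNum p (a + 1) := by
    rw [show a + b + 1 + 1 = (b + 1) + (a + 1) by ring]
    simp only [qNum]
    rw [Finset.sum_range_add, Finset.mul_sum]
    simp only [pow_add]
  simp only [qBinom]
  rw [show a + 1 + (b + 1) = a + b + 1 + 1 by ring, show a + (b + 1) = a + b + 1 by ring,
    show a + 1 + b = a + b + 1 by ring, qFact_succ p (a + b + 1), qFact_succ p a, qFact_succ p b,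
    key]
  field_simp
  ring

theorem qBinom_mono {p : ℝ} (hp : 0 ≤ p) (a b c : ℕ) : qBinom p a b ≤ qBinom p a (b + c) := by
  induction c with
  | zero => exact le_rfl
  | succ c ih =>
    refine ih.trans ?_
    rcases a with _ | a
    · rw [qBinom_zero_left hp, qBinom_zero_left hp]
    · rw [← add_assoc, qBinom_succ hp]
      have := (qBinom_pos hp a (b + c + 1)).le
      have : 0 ≤ p ^ (b + c + 1) * qBinom p a (b + c + 1) := by positivity
      linarith

/-- A consequence of the `q`-Chu–Vandermonde formula. -/
theorem qBinom_mul_le {p : ℝ} (hp : 0 ≤ p) (i i' j j' : ℕ) :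
    p ^ (j * i') * (qBinom p i i' * qBinom p j j') ≤ qBinom p (i + j) (i' + j') := by
  induction j generalizing j' with
  | zero =>
    rw [zero_mul, pow_zero, one_mul, qBinom_zero_left hp, mul_one]
    exact qBinom_mono hp i i' j'
  | succ j ihj =>
    induction j' with
    | zero =>
      have h0 := ihj 0
      rw [qBinom_zero_right hp, mul_one, add_zero] at h0 ⊢
      rcases i' with _ | i'
      · rw [qBinom_zero_right hp, qBinom_zero_right hp]; simp
      · rw [← add_assoc, qBinom_succ hp]
        have h1 := (qBinom_pos hp (i + j + 1) i').le
        have h2 := mul_le_mul_of_nonneg_left h0 (pow_nonneg hp (i' + 1))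
        have h3 : p ^ ((j + 1) * (i' + 1)) * qBinom p i (i' + 1)
            = p ^ (i' + 1) * (p ^ (j * (i' + 1)) * qBinom p i (i' + 1)) := by ring
        rw [h3]
        linarith
    | succ j' ihj' =>
      rw [← add_assoc, ← add_assoc, qBinom_succ hp (i + j), qBinom_succ hp j]
      have h1 := mul_le_mul_of_nonneg_left (ihj (j' + 1)) (pow_nonneg hp (i' + j' + 1))
      rw [← add_assoc] at h1 ihj'
      have h3 : p ^ ((j + 1) * i') * (qBinom p i i' *
          (p ^ (j' + 1) * qBinom p j (j' + 1) + qBinom p (j + 1) j'))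
          = p ^ (i' + j' + 1) * (p ^ (j * i') * (qBinom p i i' * qBinom p j (j' + 1)))
            + p ^ ((j + 1) * i') * (qBinom p i i' * qBinom p (j + 1) j') := by ring
      rw [h3]
      exact add_le_add h1 ihj'

theorem qBinom_prod_le {n : ℕ} {p : ℝ} (hp : 0 ≤ p) (k l : Fin n →₀ ℕ) (s : Finset (Fin n)) :
    p ^ (∑ i ∈ s, ∑ j ∈ s with i < j, k j * l i) * ∏ i ∈ s, qBinom p (k i) (l i)
      ≤ qBinom p (∑ i ∈ s, k i) (∑ i ∈ s, l i) := by
  induction s using Finset.induction_on_max with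
  | empty => simp [qBinom_zero_left hp]
  | insert a s ha ih =>
    have hns : a ∉ s := fun h => lt_irrefl _ (ha a h)
    have e1 : ∑ i ∈ insert a s, ∑ j ∈ insert a s with i < j, k j * l i
        = k a * (∑ i ∈ s, l i) + ∑ i ∈ s, ∑ j ∈ s with i < j, k j * l i := by
      rw [Finset.sum_insert hns, Finset.filter_false_of_mem, Finset.sum_empty, zero_add,
        Finset.mul_sum, ← Finset.sum_add_distrib]
      · refine Finset.sum_congr rfl fun i hi => ?_
        rw [Finset.filter_insert, if_pos (ha i hi), Finset.sum_insert]
        simp [hns]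
      · intro j hj
        rcases Finset.mem_insert.1 hj with rfl | hj
        · exact lt_irrefl _
        · exact (ha j hj).not_gt
    rw [e1, Finset.prod_insert hns, Finset.sum_insert hns, Finset.sum_insert hns, pow_add,
      add_comm (k a), add_comm (l a)]
    refine le_trans ?_ (qBinom_mul_le hp _ _ _ _)
    have h2 := mul_le_mul_of_nonneg_left ih
      (mul_nonneg (pow_nonneg hp (k a * ∑ i ∈ s, l i)) (qBinom_pos hp (k a) (l a)).le)
    refine le_trans (le_of_eq ?_) (h2.trans (le_of_eq ?_)) <;> ring

/-- The weight `([k]_p! / [|k|]_p!)^(1/2)` with `p = |q|⁻²`, where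
`[k]_p! = [k_1]_p! ⋯ [k_n]_p!`. -/
def ballWeight {n : ℕ} (q : ℂ) (k : Fin n →₀ ℕ) : ℝ :=
  √((∏ i, qFact ((‖q‖ ^ 2)⁻¹) (k i)) / qFact ((‖q‖ ^ 2)⁻¹) (∑ i, k i))

theorem ballWeight_nonneg {n : ℕ} (q : ℂ) (k : Fin n →₀ ℕ) : 0 ≤ ballWeight q k :=
  Real.sqrt_nonneg _

theorem ballWeight_add_le {n : ℕ} (q : ℂ) (k l : Fin n →₀ ℕ) :
    ‖q⁻¹ ^ twist k l‖ * ballWeight q (k + l) ≤ ballWeight q k * ballWeight q l := by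
  have hp : 0 ≤ (‖q‖ ^ 2)⁻¹ := by positivity
  have h0 := qBinom_prod_le hp k l Finset.univ
  have h1 : ‖q⁻¹ ^ twist k l‖ = √((‖q‖ ^ 2)⁻¹ ^ twist k l) := by
    rw [norm_pow, norm_inv, ← inv_pow, ← pow_mul, mul_comm 2, pow_mul, Real.sqrt_sq (by positivity)]
  have hE : ∑ i, ∑ j with i < j, k j * l i = twist k l := by
    refine Finset.sum_congr rfl fun i _ => ?_
    congr 1
    ext j
    simp
  rw [hE] at h0
  have hK := Finset.prod_pos fun i (_ : i ∈ (Finset.univ : Finset (Fin n))) => qFact_pos hp (k i)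
  have hL := Finset.prod_pos fun i (_ : i ∈ (Finset.univ : Finset (Fin n))) => qFact_pos hp (l i)
  have hk := qFact_pos hp (∑ i, k i)
  have hl := qFact_pos hp (∑ i, l i)
  have hkl := qFact_pos hp (∑ i, k i + ∑ i, l i)
  rw [h1, ballWeight, ballWeight, ballWeight, ← Real.sqrt_mul (by positivity),
    ← Real.sqrt_mul (by positivity)]
  refine Real.sqrt_le_sqrt ?_
  simp only [Finsupp.add_apply, Finset.sum_add_distrib]
  simp only [qBinom, Finset.prod_div_distrib, Finset.prod_mul_distrib] at h0
  rw [div_mul_div_comm, mul_div_assoc', div_le_div_iff₀ hkl (by positivity)]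
  rw [mul_div_assoc', div_le_div_iff₀ (by positivity) (by positivity)] at h0
  linarith

namespace QSeries

variable {n : ℕ} {q : ℂ}

/-- The terms `|c_k| ([k]! / [|k|]!)^(1/2) ρ^|k|` of the norm `‖·‖_ρ`. -/
def normTerm (ρ : ℝ) (a : QSeries n q) (k : Fin n →₀ ℕ) : ℝ :=
  ‖a.coeff k‖ * ballWeight q k * ρ ^ (∑ i, k i)

theorem normTerm_nonneg {ρ : ℝ} (hρ : 0 < ρ) (a : QSeries n q) (k : Fin n →₀ ℕ) :
    0 ≤ normTerm ρ a k := by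
  have := ballWeight_nonneg q k
  unfold normTerm
  positivity

theorem normTerm_add_le {ρ : ℝ} (hρ : 0 < ρ) (a b : QSeries n q) (k : Fin n →₀ ℕ) :
    normTerm ρ (a + b) k ≤ normTerm ρ a k + normTerm ρ b k := by
  have := ballWeight_nonneg q k
  unfold normTerm
  rw [← add_mul, ← add_mul, coeff_add]
  gcongr
  exact norm_add_le _ _

theorem normTerm_smul (ρ : ℝ) (c : ℂ) (a : QSeries n q) (k : Fin n →₀ ℕ) :
    normTerm ρ (c • a) k = ‖c‖ * normTerm ρ a k := by
  simp only [normTerm, coeff_smul, norm_mul]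
  ring

theorem normTerm_mul_le {ρ : ℝ} (hρ : 0 < ρ) (a b : QSeries n q) (m : Fin n →₀ ℕ) :
    normTerm ρ (a * b) m ≤
      ∑ kl ∈ Finset.HasAntidiagonal.antidiagonal m, normTerm ρ a kl.1 * normTerm ρ b kl.2 := by
  have hw := ballWeight_nonneg q m
  rw [normTerm, coeff_mul]
  calc _ ≤ (∑ kl ∈ Finset.HasAntidiagonal.antidiagonal m,
        ‖q⁻¹ ^ twist kl.1 kl.2 * (a.coeff kl.1 * b.coeff kl.2)‖) * ballWeight q m
          * ρ ^ (∑ i, m i) := by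
        gcongr
        exact norm_sum_le _ _
    _ ≤ _ := by
        rw [Finset.sum_mul, Finset.sum_mul]
        refine Finset.sum_le_sum ?_
        rintro ⟨k, l⟩ hkl
        rw [Finset.HasAntidiagonal.mem_antidiagonal] at hkl
        subst hkl
        have h1 := mul_le_mul_of_nonneg_left (ballWeight_add_le q k l)
          (show 0 ≤ ‖a.coeff k‖ * ‖b.coeff l‖ * ρ ^ (∑ i, (k i + l i)) by positivity)
        simp only [normTerm, norm_mul, Finsupp.add_apply]
        refine le_trans (le_of_eq ?_) (h1.trans (le_of_eq ?_))
        · ring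
        · rw [Finset.sum_add_distrib, pow_add]; ring

theorem summable_normTerm_mul {ρ : ℝ} (hρ : 0 < ρ) {a b : QSeries n q}
    (ha : Summable (normTerm ρ a)) (hb : Summable (normTerm ρ b)) :
    Summable (normTerm ρ (a * b)) :=
  Summable.of_nonneg_of_le (normTerm_nonneg hρ _) (normTerm_mul_le hρ a b)
    (summable_sum_mul_antidiagonal_of_summable_mul
      (ha.mul_of_nonneg hb (normTerm_nonneg hρ a) (normTerm_nonneg hρ b)))

theorem summable_normTerm_monomial (ρ : ℝ) (k : Fin n →₀ ℕ) (c : ℂ) :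
    Summable (normTerm ρ (monomial k c : QSeries n q)) := by
  refine summable_of_ne_finset_zero (s := {k}) fun l hl => ?_
  rw [normTerm, coeff_monomial, if_neg (by simpa using hl)]
  simp

end QSeries

/-- The radii `0 < ρ < r`. -/
abbrev Radius (r : ℝ≥0∞) : Type := {ρ : ℝ // 0 < ρ ∧ ENNReal.ofReal ρ < r}

/-- The algebra of holomorphic functions on the quantum ball of radius `r`: the series for which
all the norms `‖·‖_ρ`, `0 < ρ < r`, are finite. -/
def ballSubalgebra (n : ℕ) (q : ℂ) (r : ℝ≥0∞) : Subalgebra ℂ (QSeries n q) where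
  carrier := {a | ∀ ρ : Radius r, Summable (QSeries.normTerm ρ.1 a)}
  mul_mem' ha hb ρ := QSeries.summable_normTerm_mul ρ.2.1 (ha ρ) (hb ρ)
  add_mem' ha hb ρ := Summable.of_nonneg_of_le (QSeries.normTerm_nonneg ρ.2.1 _)
    (QSeries.normTerm_add_le ρ.2.1 _ _) ((ha ρ).add (hb ρ))
  algebraMap_mem' c ρ := by
    rw [Algebra.algebraMap_eq_smul_one]
    refine ((QSeries.summable_normTerm_monomial (q := q) ρ.1 0 1).mul_left ‖c‖).congr fun k => ?_
    exact (QSeries.normTerm_smul ρ.1 c 1 k).symm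

/-- The algebra `O_q(𝔹ⁿ_r)`. -/
abbrev QBall (n : ℕ) (q : ℂ) (r : ℝ≥0∞) : Type := ballSubalgebra n q r

namespace QBall

variable {n : ℕ} {q : ℂ} {r : ℝ≥0∞}

/-- The norm `‖a‖_ρ = ∑ |c_k| ([k]! / [|k|]!)^(1/2) ρ^|k|`. -/
def norm (ρ : Radius r) : Seminorm ℂ (QBall n q r) :=
  Seminorm.of (fun a => ∑' k, QSeries.normTerm ρ.1 a.1 k)
    (fun a b => by
      rw [← (a.2 ρ).tsum_add (b.2 ρ)]
      exact Summable.tsum_le_tsum (QSeries.normTerm_add_le ρ.2.1 a.1 b.1) ((a + b).2 ρ)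
        ((a.2 ρ).add (b.2 ρ)))
    (fun c a => by
      rw [← tsum_mul_left]
      exact tsum_congr fun k => QSeries.normTerm_smul ρ.1 c a.1 k)

/-- The topology determined by the norms `‖·‖_ρ`, `0 < ρ < r`. -/
instance : TopologicalSpace (QBall n q r) :=
  ⨅ ρ : Radius r, (norm ρ).toSeminormedAddCommGroup.toUniformSpace.toTopologicalSpace

/-- The element `x_i`. -/
def x (i : Fin n) : QBall n q r :=
  ⟨QSeries.x i, fun ρ => QSeries.summable_normTerm_monomial ρ.1 _ 1⟩

end QBall

/-! ### The completion of the quantum affine space -/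

namespace Aff

variable {n : ℕ} {q : Set.Ioo (0 : ℝ) 1}

/-- The norm `‖a‖_op = ‖π(a)‖` on the quantum affine space. -/
def opNorm : Seminorm ℂ (Aff n ((q : ℝ) : ℂ)) :=
  (normSeminorm ℂ (Fock n →L[ℂ] Fock n)).comp
    (((Fock.rep q).toAlgHom.comp Pol.ofAff).toLinearMap)

theorem opNorm_apply (a : Aff n ((q : ℝ) : ℂ)) :
    opNorm a = ‖Fock.rep q (Pol.ofAff a)‖ := rfl

/-- The norm `‖a‖^∞_ρ = ‖γ_ρ(a)‖_op`. -/
def supNorm (ρ : ℝ) : Seminorm ℂ (Aff n ((q : ℝ) : ℂ)) := opNorm.comp (gamma ρ).toLinearMap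

theorem supNorm_apply (ρ : ℝ) (a : Aff n ((q : ℝ) : ℂ)) :
    supNorm ρ a = opNorm (gamma ρ a) := rfl

theorem supNorm_mul_le (ρ : ℝ) (a b : Aff n ((q : ℝ) : ℂ)) :
    supNorm ρ (a * b) ≤ supNorm ρ a * supNorm ρ b := by
  simp only [supNorm_apply, opNorm_apply, map_mul]
  exact norm_mul_le _ _

end Aff

/-- The quantum affine space equipped with the family of norms `‖·‖^∞_ρ`, `0 < ρ < r`. -/
def AffSup (n : ℕ) (q : Set.Ioo (0 : ℝ) 1) (_r : ℝ≥0∞) : Type := Aff n ((q : ℝ) : ℂ)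

namespace AffSup

variable {n : ℕ} {q : Set.Ioo (0 : ℝ) 1} {r : ℝ≥0∞}

instance : Ring (AffSup n q r) := inferInstanceAs (Ring (Aff n ((q : ℝ) : ℂ)))

instance : Algebra ℂ (AffSup n q r) := inferInstanceAs (Algebra ℂ (Aff n ((q : ℝ) : ℂ)))

/-- The norm `‖·‖^∞_ρ`. -/
def norm (ρ : Radius r) : Seminorm ℂ (AffSup n q r) := Aff.supNorm (q := q) ρ.1

theorem norm_mul_le (ρ : Radius r) (a b : AffSup n q r) :
    norm ρ (a * b) ≤ norm ρ a * norm ρ b := Aff.supNorm_mul_le ρ.1 a b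

/-- The uniform structure determined by the norms `‖·‖^∞_ρ`, `0 < ρ < r`. -/
instance : UniformSpace (AffSup n q r) :=
  ⨅ ρ : Radius r, (norm ρ).toSeminormedAddCommGroup.toUniformSpace

instance : IsUniformAddGroup (AffSup n q r) :=
  isUniformAddGroup_iInf fun ρ => by
    let := (norm (n := n) (q := q) ρ).toSeminormedAddCommGroup
    infer_instance

/-- The norm `‖·‖^∞_ρ` as a seminormed ring structure. -/
abbrev seminormedRing (ρ : Radius r) : SeminormedRing (AffSup n q r) :=
  { (norm ρ).toSeminormedAddCommGroup, (inferInstance : Ring (AffSup n q r)) with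
    norm_mul_le := norm_mul_le ρ }

instance : IsTopologicalRing (AffSup n q r) where
  toContinuousMul := by
    rw [show (UniformSpace.toTopologicalSpace : TopologicalSpace (AffSup n q r)) = _ from
      UniformSpace.toTopologicalSpace_iInf]
    refine continuousMul_iInf fun ρ => ?_
    exact @NonUnitalSeminormedRing.toContinuousMul _
      (seminormedRing (n := n) (q := q) ρ).toNonUnitalSeminormedRing

instance : ContinuousConstSMul ℂ (AffSup n q r) where
  continuous_const_smul c := by
    simp only [Algebra.smul_def]
    exact continuous_const_mul _

instance : UniformContinuousConstSMul ℂ (AffSup n q r) :=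
  uniformContinuousConstSMul_of_continuousConstSMul ℂ (AffSup n q r)

/-- The element `x_i`. -/
def x (i : Fin n) : AffSup n q r := Aff.x (q := ((q : ℝ) : ℂ)) i

end AffSup

/-- The completion of the quantum affine space with respect to the norms `‖·‖^∞_ρ`,
`0 < ρ < r`. -/
abbrev AffCompletion (n : ℕ) (q : Set.Ioo (0 : ℝ) 1) (r : ℝ≥0∞) : Type :=
  UniformSpace.Completion (AffSup n q r)

end QuantumBall

end

noncomputable section

namespace QuantumBall

/-! The operator of `x^k` in the Fock representation is a weighted shift `e_m ↦ M(k, m) e_(k + m)`,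
and its weights are explicit: `M(k, m) = q ^ twist (k + m) k * amp (k + m) / amp m`, where `amp k ^
2` is the product of the Pochhammer symbols `(q²; q²)_(k_j)`. The weights are at most `q ^ twist k
k` for all `m`, and on the vacuum `M(k, 0) = q ^ twist k k * amp k`. The decisive identity is
`monomialCoef_zero_right_sq`: `M(k, 0)²` is the square of the weight of the ball norm times `(q²;
q²)_|k|`. Finite Pochhammer products lie between a positive constant and `1` (`exists_le_poch`), so
the vacuum norm of `x^k`, the bound `q ^ twist k k` for its operator norm and the weight of the ball
norm agree up to constants independent of `k`. This makes the two families of norms equivalent on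
polynomials. In one direction the triangle inequality gives a bound at the same radius
(`Aff.exists_supNorm_le`). In the other, the `e_k`-coordinate of the vacuum image of `a` is a
multiple of the coefficient of `x^k`, which yields Cauchy estimates (`Aff.norm_coeff_le`). Summing
these from a larger radius `σ` costs only the convergent series of `(ρ/σ)^|k|`
(`Aff.exists_norm_toQBall_le`). Hence the canonical map from the quantum affine space to the ball
algebra induces the topology of the operator norms. Its range is dense, since power series converge
to their sums, and the ball algebra is Hausdorff and complete, being a closed subspace of a product
of `ℓ¹`-spaces. It is therefore a completion, and uniqueness of completions gives the homeomorphism;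
the algebraic identities extend by density. -/

theorem finsupp_induction_add_single {ι : Type*} {P : (ι →₀ ℕ) → Prop} (h0 : P 0)
    (h1 : ∀ k i, P k → P (k + Finsupp.single i 1)) (k : ι →₀ ℕ) : P k := by
  have key : ∀ k l, P l → P (l + k) := by
    intro k
    induction k using Finsupp.induction_linear with
    | zero => simp
    | add k k' hk hk' => intro l hl; rw [← add_assoc]; exact hk' _ (hk _ hl)
    | single i m =>
      intro l hl
      induction m with
      | zero => simpa using hl
      | succ m ih => rw [Finsupp.single_add, ← add_assoc]; exact h1 _ _ ih
  simpa using key k 0 h0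

/-! ### The finite products `(1 - p) ⋯ (1 - p^a)` -/

/-- The `q`-Pochhammer symbol `(p; p)_a = (1 - p) (1 - p²) ⋯ (1 - p^a)`. -/
def poch (p : ℝ) (a : ℕ) : ℝ := ∏ s ∈ Finset.range a, (1 - p ^ (s + 1))

theorem poch_succ (p : ℝ) (a : ℕ) : poch p (a + 1) = poch p a * (1 - p ^ (a + 1)) :=
  Finset.prod_range_succ _ _

theorem poch_zero (p : ℝ) : poch p 0 = 1 := Finset.prod_range_zero _

theorem one_sub_pow_succ_pos {p : ℝ} (h0 : 0 < p) (h1 : p < 1) (s : ℕ) : 0 < 1 - p ^ (s + 1) :=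
  sub_pos.2 (pow_lt_one₀ h0.le h1 s.succ_ne_zero)

theorem poch_pos {p : ℝ} (h0 : 0 < p) (h1 : p < 1) (a : ℕ) : 0 < poch p a :=
  Finset.prod_pos fun s _ => one_sub_pow_succ_pos h0 h1 s

theorem poch_antitone {p : ℝ} (h0 : 0 < p) (h1 : p < 1) : Antitone (poch p) :=
  antitone_nat_of_succ_le fun a => by
    rw [poch_succ]
    exact mul_le_of_le_one_right (poch_pos h0 h1 a).le (by linarith [pow_pos h0 (a + 1)])

theorem poch_le_one {p : ℝ} (h0 : 0 < p) (h1 : p < 1) (a : ℕ) : poch p a ≤ 1 := poch_zero p ▸ poch_antitone h0 h1 a.zero_le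

/-- Each factor is at least `exp (-p^s / (1 - p))`, and these exponents sum to at most `(1 - p)⁻²`
in absolute value. This uniform bound is what makes the norms comparable. -/
theorem exists_le_poch {p : ℝ} (h0 : 0 < p) (h1 : p < 1) : ∃ c : ℝ, 0 < c ∧ ∀ a, c ≤ poch p a := by
  have hp : 0 < 1 - p := sub_pos.2 h1
  refine ⟨Real.exp (-(1 - p)⁻¹ ^ 2), Real.exp_pos _, fun a => ?_⟩
  have key : ∀ s, Real.exp (-(p ^ s * (1 - p)⁻¹)) ≤ 1 - p ^ (s + 1) := by
    intro s
    have hs := one_sub_pow_succ_pos h0 h1 s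
    have hle : p ^ (s + 1) ≤ p := by
      simpa using pow_le_pow_of_le_one h0.le h1.le (show 1 ≤ s + 1 by omega)
    rw [Real.exp_neg, inv_le_comm₀ (Real.exp_pos _) hs]
    refine le_trans ?_ (Real.add_one_le_exp _)
    -- In the form `1 + u`, the inverse can be compared with `1 + p^s / (1 - p)`, which is below the
    -- exponential.
    have e1 : (1 - p ^ (s + 1))⁻¹ = p ^ (s + 1) * (1 - p ^ (s + 1))⁻¹ + 1 := by
      field_simp; ring
    rw [e1]
    gcongr ?_ * ?_ + 1
    · exact pow_le_pow_of_le_one h0.le h1.le s.le_succ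
    · exact inv_anti₀ hp (by linarith)
  calc Real.exp (-(1 - p)⁻¹ ^ 2) ≤ Real.exp (∑ s ∈ Finset.range a, -(p ^ s * (1 - p)⁻¹)) := by
        refine Real.exp_le_exp.2 ?_
        rw [Finset.sum_neg_distrib, ← Finset.sum_mul, sq]
        refine neg_le_neg (mul_le_mul_of_nonneg_right ?_ (inv_nonneg.2 hp.le))
        rw [← tsum_geometric_of_lt_one h0.le h1]
        exact (summable_geometric_of_lt_one h0.le h1).sum_le_tsum _ fun s _ => by positivity
    _ = ∏ s ∈ Finset.range a, Real.exp (-(p ^ s * (1 - p)⁻¹)) := Real.exp_sum _ _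
    _ ≤ poch p a := Finset.prod_le_prod (fun s _ => (Real.exp_pos _).le) fun s _ => key s

/-- Links the `q⁻²`-numbers in the weights of the ball norm with the Pochhammer factors produced by
the creation operators. -/
theorem qNum_inv_mul {p : ℝ} (h0 : 0 < p) (a : ℕ) : qNum p⁻¹ (a + 1) * (p ^ a * (1 - p)) = 1 - p ^ (a + 1) := by
  induction a with
  | zero => simp [qNum]
  | succ a ih =>
    rw [qNum, Finset.sum_range_succ, add_mul, ← qNum,
      show p ^ (a + 1) * (1 - p) = p * (p ^ a * (1 - p)) by ring, ← mul_assoc (qNum _ _),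
      mul_comm (qNum _ _), mul_assoc, ih, inv_pow]
    field_simp
    ring

/-! ### Exponents of `q` from reordering monomials -/

theorem twist_single_right {n : ℕ} (k : Fin n →₀ ℕ) (i : Fin n) :
    twist k (Finsupp.single i 1) = ∑ j ∈ Finset.Ioi i, k j := by
  rw [twist, Finset.sum_eq_single i] <;> simp +contextual [eq_comm]

theorem twist_single_left {n : ℕ} (k : Fin n →₀ ℕ) (i : Fin n) :
    twist (Finsupp.single i 1) k = ∑ j ∈ Finset.Iio i, k j := by
  rw [twist, ← Finset.sum_subset (Finset.subset_univ (Finset.Iio i))]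
  · refine Finset.sum_congr rfl fun j hj => ?_
    rw [Finset.sum_eq_single i] <;> simp_all [eq_comm]
  · intro j _ hj
    refine Finset.sum_eq_zero fun l hl => ?_
    have : l ≠ i := by rintro rfl; simp_all
    simp [this.symm]

theorem twist_single_self {n : ℕ} (i : Fin n) :
    twist (Finsupp.single i 1 : Fin n →₀ ℕ) (Finsupp.single i 1) = 0 := by
  simp [QSeries.twist_single]

/-- Indices above `i` are counted by the first twist, indices below `i` by the second. -/
theorem add_twist_single_add_twist_single {n : ℕ} (k : Fin n →₀ ℕ) (i : Fin n) :
    k i + (twist k (Finsupp.single i 1) + twist (Finsupp.single i 1) k) = ∑ j, k j := by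
  rw [twist_single_right, twist_single_left, ← Finset.add_sum_erase _ _ (Finset.mem_univ i),
    ← Finset.sum_union]
  · congr 2
    ext j
    simp [lt_or_lt_iff_ne, eq_comm]
  · rw [Finset.disjoint_left]
    intro j hj hj'
    simp at hj hj'
    exact absurd hj hj'.not_gt

/-! ### Weights of the monomials in the Fock representation -/

namespace Fock

variable {n : ℕ} (q : Set.Ioo (0 : ℝ) 1)

theorem sq_pos : 0 < (q : ℝ) ^ 2 := pow_pos q.2.1 2

theorem sq_lt_one : (q : ℝ) ^ 2 < 1 := pow_lt_one₀ q.2.1.le q.2.2 two_ne_zero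

/-- The norm of `x^k e_0` up to a power of `q`. -/
def amp (k : Fin n →₀ ℕ) : ℝ := √(∏ j, poch ((q : ℝ) ^ 2) (k j))

theorem amp_sq (k : Fin n →₀ ℕ) : amp q k ^ 2 = ∏ j, poch ((q : ℝ) ^ 2) (k j) :=
  Real.sq_sqrt (Finset.prod_nonneg fun _ _ => (poch_pos (sq_pos q) (sq_lt_one q) _).le)

theorem amp_pos (k : Fin n →₀ ℕ) : 0 < amp q k :=
  Real.sqrt_pos.2 (Finset.prod_pos fun _ _ => poch_pos (sq_pos q) (sq_lt_one q) _)

theorem amp_zero : amp q (0 : Fin n →₀ ℕ) = 1 := by simp [amp, poch_zero]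

theorem amp_add_le (k m : Fin n →₀ ℕ) : amp q (k + m) ≤ amp q m :=
  Real.sqrt_le_sqrt (Finset.prod_le_prod
    (fun _ _ => (poch_pos (sq_pos q) (sq_lt_one q) _).le)
    fun _ _ => poch_antitone (sq_pos q) (sq_lt_one q) (by simp))

theorem prod_add_single {M : Type*} [CommMonoid M] (f : ℕ → M) (g : ℕ → M)
    (hf : ∀ a, f (a + 1) = f a * g a) (k : Fin n →₀ ℕ) (i : Fin n) :
    ∏ j, f ((k + Finsupp.single i 1 : Fin n →₀ ℕ) j) = (∏ j, f (k j)) * g (k i) := by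
  rw [← Finset.mul_prod_erase _ _ (Finset.mem_univ i),
    ← Finset.mul_prod_erase (Finset.univ) (fun j => f (k j)) (Finset.mem_univ i),
    Finset.prod_congr rfl (g := fun j => f (k j)) (s₁ := Finset.univ.erase i)]
  · simp [hf, mul_right_comm]
  · intro j hj
    rw [Finsupp.add_apply, Finsupp.single_eq_of_ne (Finset.ne_of_mem_erase hj), add_zero]

/-- In the rescaled basis `amp m • e_m` the creation operators have pure powers of `q` as
coefficients: the factor `1 - q^(2(m_i + 1))` of `coef ^ 2` is the one that `amp ^ 2` gains. -/
theorem coef_mul_amp (i : Fin n) (m : Fin n →₀ ℕ) :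
    coef q i m * amp q m
      = (q : ℝ) ^ twist m (Finsupp.single i 1) * amp q (m + Finsupp.single i 1) := by
  have hq := q.2.1
  rw [← sq_eq_sq₀ (mul_nonneg (coef_nonneg q i m) (amp_pos q m).le)
    (mul_nonneg (by positivity) (amp_pos q _).le), mul_pow, mul_pow, coef_sq, amp_sq, amp_sq,
    prod_add_single _ _ (poch_succ _), twist_single_right]
  ring

/-- The coefficient of `e_(k + m)` in `π(x^k) e_m`. -/
def monomialCoef (k m : Fin n →₀ ℕ) : ℝ :=
  (q : ℝ) ^ twist (k + m) k * (amp q (k + m) / amp q m)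

theorem monomialCoef_pos (k m : Fin n →₀ ℕ) : 0 < monomialCoef q k m := by
  have := q.2.1
  have := amp_pos q m
  have := amp_pos q (k + m)
  unfold monomialCoef
  positivity

/-- Both `amp (k + m) / amp m` and the extra factor `q ^ twist m k` are at most `1`. The bound does
not depend on `m`, so it bounds an operator norm. -/
theorem monomialCoef_le (k m : Fin n →₀ ℕ) : monomialCoef q k m ≤ (q : ℝ) ^ twist k k := by
  have h := q.2.1
  refine (mul_le_of_le_one_right (pow_nonneg h.le _)
    (div_le_one_of_le₀ (amp_add_le q k m) (amp_pos q m).le)).trans ?_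
  rw [twist_add_left]
  exact pow_le_pow_of_le_one h.le q.2.2.le (Nat.le_add_right _ _)

theorem monomialCoef_zero_left (m : Fin n →₀ ℕ) : monomialCoef q 0 m = 1 := by
  simp [monomialCoef, (amp_pos q m).ne']

theorem monomialCoef_zero_right (k : Fin n →₀ ℕ) :
    monomialCoef q k 0 = (q : ℝ) ^ twist k k * amp q k := by
  simp [monomialCoef, amp_zero]

/-- The matrix-coefficient form of `x_i x^k = q^(-twist ε_i k) x^(k + ε_i)`. -/
theorem coef_mul_monomialCoef (i : Fin n) (k m : Fin n →₀ ℕ) :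
    (q : ℝ) ^ twist (Finsupp.single i 1) k * (coef q i (k + m) * monomialCoef q k m)
      = monomialCoef q (k + Finsupp.single i 1) m := by
  have h : k + Finsupp.single i 1 + m = k + m + Finsupp.single i 1 := add_right_comm _ _ _
  have h2 := coef_mul_amp q i (k + m)
  unfold monomialCoef
  rw [h, twist_add_left (k + m), twist_add_right, twist_add_right, twist_single_self, add_zero,
    pow_add, pow_add]
  linear_combination (q : ℝ) ^ twist (k + m) k * (q : ℝ) ^ twist (Finsupp.single i 1) k /
    amp q m * h2

/-- The norms of `π(x^k) e_0` and the weights of the norm on the quantum ball. -/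
theorem monomialCoef_zero_right_sq (k : Fin n →₀ ℕ) :
    monomialCoef q k 0 ^ 2
      = ballWeight ((q : ℝ) : ℂ) k ^ 2 * poch ((q : ℝ) ^ 2) (∑ i, k i) := by
  have hp := sq_pos q
  have hp1 := sq_lt_one q
  have hinv : 0 ≤ ((q : ℝ) ^ 2)⁻¹ := inv_nonneg.2 hp.le
  have hw : ∀ k : Fin n →₀ ℕ, ballWeight ((q : ℝ) : ℂ) k ^ 2 =
      (∏ i, qFact ((q : ℝ) ^ 2)⁻¹ (k i)) / qFact ((q : ℝ) ^ 2)⁻¹ (∑ i, k i) := by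
    intro k
    rw [ballWeight, Complex.norm_real, Real.norm_of_nonneg q.2.1.le, Real.sq_sqrt]
    exact div_nonneg (Finset.prod_nonneg fun i _ => (qFact_pos hinv _).le) (qFact_pos hinv _).le
  rw [monomialCoef_zero_right, mul_pow, amp_sq, hw]
  induction k using finsupp_induction_add_single with
  | h0 => simp [poch_zero, qFact]
  | h1 k i ih =>
    rw [prod_add_single _ _ (poch_succ _), prod_add_single _ _ (qFact_succ _), twist_add_left,
      twist_add_right, twist_add_right, twist_single_self, add_zero]
    simp only [Finsupp.add_apply, Finset.sum_add_distrib]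
    rw [show ∑ j, (Finsupp.single i 1 : Fin n →₀ ℕ) j = 1 by simp [Finsupp.single_apply],
      poch_succ, qFact_succ]
    -- Passing from `k` to `k + ε_i` multiplies the left side by `q^(2t) (1 - q^(2(k_i + 1)))`, with
    -- `t` the sum of the two twists, and the right side by `[k_i + 1] / [|k| + 1] * (1 - q^(2(|k| +
    -- 1)))`. After rewriting both differences through `q⁻²`-numbers, the factors agree because `k_i
    -- + t = |k|`.
    have e1 := qNum_inv_mul hp (k i)
    have e2 := qNum_inv_mul hp (∑ j, k j)
    have e3 := add_twist_single_add_twist_single k i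
    rw [add_assoc (twist k k), pow_add, mul_pow]
    generalize twist k (Finsupp.single i 1) + twist (Finsupp.single i 1) k = t at e3 ⊢
    generalize twist k k = s at *
    generalize (∏ i, poch ((q : ℝ) ^ 2) (k i)) = A at *
    generalize (∏ i, qFact ((q : ℝ) ^ 2)⁻¹ (k i)) = B at *
    have n1 := (qFact_pos hinv (∑ j, k j)).ne'
    have n2 := (qNum_pos hinv (∑ j, k j)).ne'
    have n3 : ((q : ℝ) ^ 2) ^ k i ≠ 0 := pow_ne_zero _ hp.ne'
    have n4 : 1 - (q : ℝ) ^ 2 ≠ 0 := by linarith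
    rw [← e1, ← e2, ← e3, pow_add ((q : ℝ) ^ 2) (k i)]
    rw [← e3] at n1 n2 ih
    rw [← pow_mul (q : ℝ) t, mul_comm t 2, pow_mul (q : ℝ) 2 t]
    rw [div_mul_eq_mul_div, eq_div_iff n1] at ih
    rw [div_mul_eq_mul_div, eq_div_iff (mul_ne_zero n1 n2)]
    linear_combination ((q : ℝ) ^ 2) ^ t * (qNum ((q : ℝ) ^ 2)⁻¹ (k i + 1) * (((q : ℝ) ^ 2) ^ k i
      * (1 - (q : ℝ) ^ 2))) * qNum ((q : ℝ) ^ 2)⁻¹ (k i + t + 1) * ih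

/-- By `monomialCoef_zero_right_sq` the ratio of the squares is `(q²; q²)_|k|`, bounded below by
some `c`; hence the constant `c^(-1/2)`. -/
theorem exists_ballWeight_le :
    ∃ C : ℝ, 0 < C ∧ ∀ k : Fin n →₀ ℕ, ballWeight ((q : ℝ) : ℂ) k ≤ C * monomialCoef q k 0 := by
  obtain ⟨c, hc, h⟩ := exists_le_poch (sq_pos q) (sq_lt_one q)
  refine ⟨(√c)⁻¹, by positivity, fun k => ?_⟩
  rw [inv_mul_eq_div, le_div_iff₀ (by positivity)]
  refine le_of_sq_le_sq ?_ (monomialCoef_pos q k 0).le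
  rw [mul_pow, Real.sq_sqrt hc.le, monomialCoef_zero_right_sq]
  gcongr
  exact h _

/-- Here the `n` Pochhammer factors inside `amp k ^ 2` are bounded below by `c` each, hence the `c ^
n`, while `(q²; q²)_|k|` is bounded above by `1`. -/
theorem exists_pow_twist_le :
    ∃ C : ℝ, 0 < C ∧ ∀ k : Fin n →₀ ℕ,
      (q : ℝ) ^ twist k k ≤ C * ballWeight ((q : ℝ) : ℂ) k := by
  obtain ⟨c, hc, h⟩ := exists_le_poch (sq_pos q) (sq_lt_one q)
  refine ⟨(√(c ^ n))⁻¹, by positivity, fun k => ?_⟩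
  have hw := ballWeight_nonneg ((q : ℝ) : ℂ) k
  have h1 := monomialCoef_zero_right_sq q k
  rw [inv_mul_eq_div, le_div_iff₀ (by positivity)]
  refine le_of_sq_le_sq ?_ hw
  rw [mul_pow, Real.sq_sqrt (by positivity)]
  calc _ ≤ ((q : ℝ) ^ twist k k) ^ 2 * ∏ j, poch ((q : ℝ) ^ 2) (k j) := by
        gcongr
        simpa using Finset.prod_le_prod (s := Finset.univ) (f := fun _ : Fin n => c)
          (fun _ _ => hc.le) fun j _ => h (k j)
    _ = monomialCoef q k 0 ^ 2 := by rw [monomialCoef_zero_right, mul_pow, amp_sq]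
    _ ≤ _ := by
        rw [h1]
        exact mul_le_of_le_one_right (by positivity) (poch_le_one (sq_pos q) (sq_lt_one q) _)

/-! ### The operators `π(x^k)` -/

/-- The coordinates of the weighted shift `e_m ↦ monomialCoef k m • e_(m + k)`. -/
def monomialFun (k : Fin n →₀ ℕ) (f : (Fin n →₀ ℕ) → ℂ) (m : Fin n →₀ ℕ) : ℂ :=
  if k ≤ m then (monomialCoef q k (m - k) : ℂ) * f (m - k) else 0

theorem monomialFun_add (k : Fin n →₀ ℕ) (f : (Fin n →₀ ℕ) → ℂ) (m : Fin n →₀ ℕ) :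
    monomialFun q k f (m + k) = (monomialCoef q k m : ℂ) * f m := by
  simp [monomialFun]

theorem monomialFun_support (k : Fin n →₀ ℕ) (f : (Fin n →₀ ℕ) → ℂ) (m : Fin n →₀ ℕ)
    (hm : m ∉ Set.range (fun m : Fin n →₀ ℕ => m + k)) : ‖monomialFun q k f m‖ ^ 2 = 0 := by
  have h : ¬ k ≤ m := fun h => hm ⟨m - k, tsub_add_cancel_of_le h⟩
  simp [monomialFun, h]

theorem norm_monomialFun_le (k : Fin n →₀ ℕ) (f : (Fin n →₀ ℕ) → ℂ) (m : Fin n →₀ ℕ) :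
    ‖monomialFun q k f (m + k)‖ ^ 2 ≤ ((q : ℝ) ^ twist k k) ^ 2 * ‖f m‖ ^ 2 := by
  have h := (monomialCoef_pos q k m).le
  rw [monomialFun_add, norm_mul, Complex.norm_real, Real.norm_of_nonneg h, mul_pow]
  gcongr
  exact monomialCoef_le q k m

theorem summable_monomialFun (k : Fin n →₀ ℕ) (f : Fock n) :
    Summable fun m => ‖monomialFun q k f m‖ ^ 2 := by
  rw [← (add_left_injective k).summable_iff (monomialFun_support q k f)]
  exact Summable.of_nonneg_of_le (fun _ => sq_nonneg _) (fun m => norm_monomialFun_le q k f m)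
    ((summable_sq f).mul_left _)

theorem tsum_monomialFun_le (k : Fin n →₀ ℕ) (f : Fock n) :
    ∑' m, ‖monomialFun q k f m‖ ^ 2 ≤ ((q : ℝ) ^ twist k k * ‖f‖) ^ 2 := by
  rw [← (add_left_injective k).tsum_eq (f := fun m => ‖monomialFun q k f m‖ ^ 2)
    (fun m hm => by
      by_contra h
      exact hm (monomialFun_support q k f m h)), mul_pow, norm_sq, ← tsum_mul_left]
  exact Summable.tsum_le_tsum (fun m => norm_monomialFun_le q k f m)
    ((add_left_injective k).summable_iff (monomialFun_support q k f) |>.2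
      (summable_monomialFun q k f)) ((summable_sq f).mul_left _)

/-- The operator `π(x^k)`. -/
def monomialOp (k : Fin n →₀ ℕ) : Fock n →L[ℂ] Fock n :=
  LinearMap.mkContinuous
    { toFun := fun f =>
        ⟨monomialFun q k f, memℓp_gen (by simpa using summable_monomialFun q k f)⟩
      map_add' := by
        intro f g
        ext m
        simp only [monomialFun, lp.coeFn_add, Pi.add_apply]
        split_ifs <;> ring
      map_smul' := by
        intro c f
        ext m
        simp only [monomialFun, lp.coeFn_smul, Pi.smul_apply, smul_eq_mul, RingHom.id_apply]
        split_ifs <;> ring } ((q : ℝ) ^ twist k k) (by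
    intro f
    have := q.2.1
    refine (sq_le_sq₀ (norm_nonneg _) (by positivity)).1 ?_
    rw [norm_sq]
    exact tsum_monomialFun_le q k f)

theorem norm_monomialOp_le (k : Fin n →₀ ℕ) : ‖monomialOp q k‖ ≤ (q : ℝ) ^ twist k k :=
  LinearMap.mkContinuous_norm_le _ (pow_nonneg q.2.1.le _) _

theorem monomialOp_apply (k : Fin n →₀ ℕ) (f : Fock n) (m : Fin n →₀ ℕ) :
    monomialOp q k f m = monomialFun q k f m := rfl

theorem monomialOp_zero : monomialOp q (0 : Fin n →₀ ℕ) = 1 := by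
  ext f m
  simp [monomialOp_apply, monomialFun, monomialCoef_zero_left]

/-- Different monomials send the vacuum to different basis lines, so coefficients of a polynomial
can be read off from its value on `e 0`. -/
theorem monomialOp_e_zero (k m : Fin n →₀ ℕ) :
    monomialOp q k (e 0) m = if m = k then (monomialCoef q k 0 : ℂ) else 0 := by
  rw [monomialOp_apply]
  by_cases h : k ≤ m
  · obtain ⟨m, rfl⟩ := exists_add_of_le h
    rw [add_comm, monomialFun_add]
    by_cases hm : m = 0
    · subst hm; simp [e]
    · simp [e, hm]
  · rw [monomialFun, if_neg h, if_neg (by rintro rfl; exact h le_rfl)]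

/-- The same rule as for left multiplication by `x_i` on monomials of the twisted power series; this
is what identifies `monomialOp` with the operators of `x^k`. -/
theorem creation_mul_monomialOp (i : Fin n) (k : Fin n →₀ ℕ) :
    creation q i * monomialOp q k
      = (((q : ℝ) : ℂ)⁻¹ ^ twist (Finsupp.single i 1) k) •
        monomialOp q (Finsupp.single i 1 + k) := by
  have hq : ((q : ℝ) : ℂ) ≠ 0 := Complex.ofReal_ne_zero.2 q.2.1.ne'
  rw [inv_pow, eq_inv_smul_iff₀ (pow_ne_zero _ hq), add_comm]
  ext f m
  change ((q : ℝ) : ℂ) ^ twist (Finsupp.single i 1) k * creation q i (monomialOp q k f) m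
    = monomialFun q (k + Finsupp.single i 1) f m
  by_cases hi : m i = 0
  · have : ¬ k + Finsupp.single i 1 ≤ m := fun h => by simpa [hi] using h i
    rw [creation_apply_zero q i _ m hi, monomialFun, if_neg this, mul_zero]
  · obtain ⟨m, rfl⟩ := exists_add hi
    rw [creation_apply_add, monomialOp_apply]
    by_cases h : k ≤ m
    · obtain ⟨m, rfl⟩ := exists_add_of_le h
      rw [add_comm k m, add_assoc, monomialFun_add, monomialFun_add,
        ← coef_mul_monomialCoef, add_comm k m]
      push_cast
      ring
    · rw [monomialFun, monomialFun, if_neg h, if_neg (by simpa using h), mul_zero, mul_zero]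

end Fock

/-! ### Multiple geometric series, norms and radii -/

theorem summable_pow_sum {ι : Type*} [Fintype ι] {t : ℝ} (h0 : 0 ≤ t) (h1 : t < 1) :
    Summable fun k : ι →₀ ℕ => t ^ (∑ i, k i) := by
  classical
  refine summable_of_sum_le (c := ∏ _i : ι, (1 - t)⁻¹) (fun _ => by positivity) fun s => ?_
  -- The finite set of exponents is enclosed in a box of side `N`, over which the sum factors into
  -- one-variable geometric sums.
  obtain ⟨N, hN⟩ : ∃ N, ∀ k ∈ s, ∀ i, k i < N := by
    refine ⟨s.sup (fun k => ∑ i, k i) + 1, fun k hk i => Nat.lt_succ_of_le ?_⟩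
    exact (Finset.single_le_sum (f := fun i => k i) (fun _ _ => Nat.zero_le _)
      (Finset.mem_univ i)).trans (Finset.le_sup (f := fun k : ι →₀ ℕ => ∑ i, k i) hk)
  calc ∑ k ∈ s, t ^ (∑ i, k i) = ∑ f ∈ s.image (fun k : ι →₀ ℕ => (k : ι → ℕ)), ∏ i, t ^ f i := by
        rw [Finset.sum_image fun _ _ _ _ h => DFunLike.coe_injective h]
        simp only [Finset.prod_pow_eq_pow_sum]
    _ ≤ ∑ f ∈ Fintype.piFinset fun _ : ι => Finset.range N, ∏ i, t ^ f i := by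
        refine Finset.sum_le_sum_of_subset_of_nonneg ?_ fun _ _ _ => by positivity
        intro f hf
        obtain ⟨k, hk, rfl⟩ := Finset.mem_image.1 hf
        simpa using hN k hk
    _ = ∏ _i : ι, ∑ m ∈ Finset.range N, t ^ m := (Finset.prod_univ_sum _ _).symm
    _ ≤ _ := by
        refine Finset.prod_le_prod (fun _ _ => by positivity) fun _ _ => ?_
        rw [← tsum_geometric_of_lt_one h0 h1]
        exact (summable_geometric_of_lt_one h0 h1).sum_le_tsum _ fun _ _ => by positivity

theorem topology_eq_induced_of_norm_eq {E F : Type*} [AddCommGroup E] [Module ℂ E]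
    [NormedAddCommGroup F] [NormedSpace ℂ F] (p : Seminorm ℂ E) (f : E →ₗ[ℂ] F)
    (h : ∀ x, ‖f x‖ = p x) :
    p.toSeminormedAddCommGroup.toUniformSpace.toTopologicalSpace =
      TopologicalSpace.induced f inferInstance := by
  let := p.toSeminormedAddCommGroup
  exact (AddMonoidHomClass.isometry_of_norm f h).isUniformInducing.isInducing.eq_induced

theorem ballWeight_pos {n : ℕ} (q : ℂ) (k : Fin n →₀ ℕ) : 0 < ballWeight q k :=
  have hp : 0 ≤ (‖q‖ ^ 2)⁻¹ := by positivity
  Real.sqrt_pos.2 (div_pos (Finset.prod_pos fun _ _ => qFact_pos hp _) (qFact_pos hp _))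

theorem Radius.exists_gt {r : ℝ≥0∞} (ρ : Radius r) : ∃ σ : Radius r, ρ.1 < σ.1 := by
  obtain ⟨σ, _, h1, h2⟩ := ENNReal.lt_iff_exists_real_btwn.1 ρ.2.2
  have h := (ENNReal.ofReal_lt_ofReal_iff_of_nonneg ρ.2.1.le).1 h1
  exact ⟨⟨σ, ρ.2.1.trans h, h2⟩, h⟩

theorem Radius.nonempty {r : ℝ≥0∞} (hr : 0 < r) : Nonempty (Radius r) := by
  obtain ⟨σ, _, h1, h2⟩ := ENNReal.lt_iff_exists_real_btwn.1 hr
  exact ⟨⟨σ, ENNReal.ofReal_pos.1 h1, h2⟩⟩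

/-! ### Completeness of the ball algebra and convergence of power series -/

namespace QBall

variable {n : ℕ} {q : ℂ} {r : ℝ≥0∞}

theorem norm_apply (ρ : Radius r) (a : QBall n q r) :
    norm ρ a = ∑' k, QSeries.normTerm ρ.1 a.1 k := rfl

instance : IsTopologicalAddGroup (QBall n q r) :=
  topologicalAddGroup_iInf fun ρ => by
    let := (norm (n := n) (q := q) ρ).toSeminormedAddCommGroup
    infer_instance

theorem norm_weighted_coeff (ρ : Radius r) (a : QBall n q r) (k : Fin n →₀ ℕ) :
    ‖a.1.coeff k * ((ballWeight q k * ρ.1 ^ (∑ i, k i) : ℝ) : ℂ)‖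
      = QSeries.normTerm ρ.1 a.1 k := by
  have := ballWeight_nonneg q k
  have := ρ.2.1
  rw [norm_mul, Complex.norm_real, Real.norm_of_nonneg (by positivity), QSeries.normTerm, mul_assoc]

/-- The weighted coefficients of an element, whose `ℓ¹`-norm is `‖·‖_ρ`. -/
def toLp (ρ : Radius r) : QBall n q r →ₗ[ℂ] lp (fun _ : Fin n →₀ ℕ => ℂ) 1 where
  toFun a := ⟨fun k => a.1.coeff k * ((ballWeight q k * ρ.1 ^ (∑ i, k i) : ℝ) : ℂ),
    memℓp_gen (by
      simpa only [norm_weighted_coeff, ENNReal.toReal_one, Real.rpow_one] using a.2 ρ)⟩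
  map_add' a b := by
    ext k
    exact add_mul (a.1.coeff k) (b.1.coeff k) _
  map_smul' c a := by
    ext k
    exact mul_assoc c (a.1.coeff k) _

theorem toLp_apply (ρ : Radius r) (a : QBall n q r) (k : Fin n →₀ ℕ) :
    toLp ρ a k = a.1.coeff k * ((ballWeight q k * ρ.1 ^ (∑ i, k i) : ℝ) : ℂ) := rfl

theorem norm_toLp (ρ : Radius r) (a : QBall n q r) : ‖toLp ρ a‖ = norm ρ a := by
  rw [lp.norm_eq_tsum_rpow (by norm_num), norm_apply]
  simp only [toLp_apply, norm_weighted_coeff, ENNReal.toReal_one, Real.rpow_one, div_one]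

theorem weight_ne_zero (ρ : Radius r) (k : Fin n →₀ ℕ) :
    ((ballWeight q k * ρ.1 ^ (∑ i, k i) : ℝ) : ℂ) ≠ 0 :=
  Complex.ofReal_ne_zero.2 (mul_pos (ballWeight_pos q k) (pow_pos ρ.2.1 _)).ne'

theorem toLp_injective (ρ : Radius r) : Function.Injective (toLp (n := n) (q := q) ρ) := by
  intro a b h
  refine Subtype.ext (QSeries.ext fun k => mul_right_cancel₀ (weight_ne_zero (q := q) ρ k) ?_)
  rw [← toLp_apply, ← toLp_apply, h]

/-- The map into the product of the `ℓ¹`-spaces. -/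
def toPi : QBall n q r →ₗ[ℂ] (Radius r → lp (fun _ : Fin n →₀ ℕ => ℂ) 1) := LinearMap.pi toLp

/-- Each `toLp ρ` is isometric for the norm at `ρ`, and the product topology is the infimum of the
topologies pulled back from the factors. -/
theorem isInducing_toPi : Topology.IsInducing (toPi (n := n) (q := q) (r := r)) := by
  refine ⟨?_⟩
  rw [show (Pi.topologicalSpace : TopologicalSpace (Radius r → lp (fun _ : Fin n →₀ ℕ => ℂ) 1))
    = ⨅ ρ, TopologicalSpace.induced (fun f => f ρ) inferInstance from rfl, induced_iInf]
  simp only [induced_compose]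
  exact iInf_congr fun ρ => topology_eq_induced_of_norm_eq _ (toLp ρ) (norm_toLp ρ)

theorem continuous_toLp (ρ : Radius r) : Continuous (toLp (n := n) (q := q) ρ) :=
  (continuous_apply ρ).comp isInducing_toPi.continuous

theorem continuous_lp_apply (k : Fin n →₀ ℕ) :
    Continuous fun f : lp (fun _ : Fin n →₀ ℕ => ℂ) 1 => f k :=
  (continuous_apply k).comp lp.uniformContinuous_coe.continuous

/-- One radius suffices, since the weight there is nonzero. Multiplicativity of the isomorphism will
be checked coefficientwise. -/
theorem continuous_coeff (hr : 0 < r) (k : Fin n →₀ ℕ) :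
    Continuous fun a : QBall n q r => a.1.coeff k := by
  obtain ⟨ρ⟩ := Radius.nonempty hr
  have := ((continuous_lp_apply k).comp (continuous_toLp (q := q) ρ)).div_const
    ((ballWeight q k * ρ.1 ^ (∑ i, k i) : ℝ) : ℂ)
  refine this.congr fun a => ?_
  rw [Function.comp_apply, toLp_apply, mul_div_cancel_right₀ _ (weight_ne_zero ρ k)]

theorem t2Space (hr : 0 < r) : T2Space (QBall n q r) := by
  obtain ⟨ρ⟩ := Radius.nonempty hr
  exact T2Space.of_injective_continuous (toLp_injective ρ) (continuous_toLp ρ)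

/-- A family comes from one series exactly when `g ρ k / ρ^|k|` does not depend on `ρ`. In
cross-multiplied form these are visibly closed conditions. -/
theorem range_toPi (hr : 0 < r) : Set.range (toPi (n := n) (q := q) (r := r)) =
    ⋂ (ρ : Radius r) (σ : Radius r) (k : Fin n →₀ ℕ),
      {g | g ρ k * ((σ.1 ^ (∑ i, k i) : ℝ) : ℂ) = g σ k * ((ρ.1 ^ (∑ i, k i) : ℝ) : ℂ)} := by
  ext g
  simp only [Set.mem_iInter, Set.mem_ofPred_eq]
  constructor
  · rintro ⟨a, rfl⟩ ρ σ k
    change toLp ρ a k * _ = toLp σ a k * _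
    rw [toLp_apply, toLp_apply]
    push_cast
    ring
  · intro h
    obtain ⟨σ⟩ := Radius.nonempty hr
    -- The coefficients are recovered at a single radius; compatibility shows that every other
    -- radius gives the same ones, and membership of `g ρ` in `ℓ¹` gives summability at `ρ`.
    let c : QSeries n q := fun k => g σ k / ((ballWeight q k * σ.1 ^ (∑ i, k i) : ℝ) : ℂ)
    have hc : ∀ (ρ : Radius r) k,
        c.coeff k * ((ballWeight q k * ρ.1 ^ (∑ i, k i) : ℝ) : ℂ) = g ρ k := by
      intro ρ k
      change g σ k / _ * _ = _
      have hσ := weight_ne_zero (q := q) σ k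
      rw [div_mul_eq_mul_div, div_eq_iff hσ]
      rw [Complex.ofReal_mul, Complex.ofReal_mul]
      linear_combination (-ballWeight q k : ℂ) * h ρ σ k
    refine ⟨⟨c, fun ρ => ?_⟩, ?_⟩
    · have := (memℓp_gen_iff (p := 1) (by norm_num)).1 (lp.memℓp (g ρ))
      refine (show Summable fun k => ‖g ρ k‖ by simpa using this).congr fun k => ?_
      have := ballWeight_nonneg q k
      have := ρ.2.1
      rw [← hc, norm_mul, Complex.norm_real, Real.norm_of_nonneg (by positivity), QSeries.normTerm,
        mul_assoc]
    · funext ρ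
      ext k
      exact hc ρ k

theorem isClosed_range_toPi (hr : 0 < r) :
    IsClosed (Set.range (toPi (n := n) (q := q) (r := r))) := by
  rw [range_toPi hr]
  refine isClosed_iInter fun ρ => isClosed_iInter fun σ => isClosed_iInter fun k => ?_
  exact isClosed_eq
    (((continuous_lp_apply k).comp (continuous_apply ρ)).mul continuous_const)
    (((continuous_lp_apply k).comp (continuous_apply σ)).mul continuous_const)

/-- The uniform structure of the topological group `O_q(𝔹ⁿ_r)`. -/
instance : UniformSpace (QBall n q r) := IsTopologicalAddGroup.rightUniformSpace (QBall n q r)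

instance : IsUniformAddGroup (QBall n q r) := isUniformAddGroup_of_addCommGroup

theorem completeSpace (hr : 0 < r) : CompleteSpace (QBall n q r) := by
  have h : IsUniformInducing (toPi (n := n) (q := q) (r := r)) :=
    AddMonoidHom.isUniformInducing_of_isInducing isInducing_toPi
  exact (completeSpace_iff_isComplete_range h).2 (isClosed_range_toPi hr).isComplete

theorem withSeminorms : WithSeminorms (norm (n := n) (q := q) (r := r)) :=
  (SeminormFamily.withSeminorms_iff_topologicalSpace_eq_iInf _).2 rfl

/-- The element `x^k`. -/
def monomial (k : Fin n →₀ ℕ) : QBall n q r :=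
  ⟨QSeries.monomial k 1, fun ρ => QSeries.summable_normTerm_monomial ρ.1 k 1⟩

theorem toLp_monomial (ρ : Radius r) (a : QBall n q r) (k : Fin n →₀ ℕ) :
    toLp ρ (a.1.coeff k • (monomial k : QBall n q r)) = lp.single 1 k (toLp ρ a k) := by
  ext l
  rw [map_smul, lp.coeFn_smul, Pi.smul_apply, toLp_apply, lp.single_apply, toLp_apply]
  by_cases h : l = k
  · subst h; simp [monomial, QSeries.coeff_monomial]
  · simp [monomial, QSeries.coeff_monomial, h]

/-- Convergence is tested in each `ℓ¹`-space, where the terms become the coordinate vectors of `toLp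
ρ a`. -/
theorem hasSum_monomial (a : QBall n q r) : HasSum (fun k => a.1.coeff k • (monomial k : QBall n q r)) a := by
  rw [HasSum, isInducing_toPi.tendsto_nhds_iff, tendsto_pi_nhds]
  intro ρ
  refine (lp.hasSum_single (by norm_num) (toLp ρ a)).congr fun s => ?_
  change _ = toLp ρ (∑ k ∈ s, _)
  rw [map_sum]
  exact Finset.sum_congr rfl fun k _ => (toLp_monomial ρ a k).symm

end QBall

/-! ### Density of the polynomials in the ball algebra -/

namespace Aff

variable {n : ℕ} {q : ℂ}

theorem induction {C : Aff n q → Prop} (hs : ∀ c : ℂ, C (algebraMap ℂ _ c)) (hx : ∀ i, C (x i))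
    (hm : ∀ a b, C a → C b → C (a * b)) (ha : ∀ a b, C a → C b → C (a + b))
    (a : Aff n q) : C a := by
  obtain ⟨a, rfl⟩ : ∃ b, mk b = a := RingQuot.mkAlgHom_surjective ℂ (AffRel n q) a
  induction a using FreeAlgebra.induction with
  | grade0 c => rw [AlgHom.commutes]; exact hs c
  | grade1 i => exact hx i
  | mul a b h1 h2 => rw [map_mul]; exact hm _ _ h1 h2
  | add a b h1 h2 => rw [map_add]; exact ha _ _ h1 h2

/-- An algebra homomorphism maps into any subspace that contains `1` and is stable under left
multiplication by the images of the generators. -/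
theorem map_mem {B : Type*} [Ring B] [Algebra ℂ B] (f : Aff n q →ₐ[ℂ] B) (M : Submodule ℂ B)
    (h1 : 1 ∈ M) (hx : ∀ i, ∀ m ∈ M, f (x i) * m ∈ M) (a : Aff n q) : f a ∈ M := by
  have key : ∀ m ∈ M, f a * m ∈ M := by
    induction a using induction with
    | hs c =>
      intro m hm
      rw [AlgHom.commutes, ← Algebra.smul_def]
      exact M.smul_mem c hm
    | hx i => exact hx i
    | hm a b ha hb => intro m hm; rw [map_mul, mul_assoc]; exact ha _ (hb _ hm)
    | ha a b ha hb => intro m hm; rw [map_add, add_mul]; exact M.add_mem (ha _ hm) (hb _ hm)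
  simpa using key 1 h1

/-- The inclusion of the quantum affine space into the functions on the quantum ball. -/
def toQBall (hq : q ≠ 0) (r : ℝ≥0∞) : Aff n q →ₐ[ℂ] QBall n q r :=
  lift QBall.x fun _ _ h => Subtype.ext (QSeries.x_mul_x hq h)

theorem toQBall_x (hq : q ≠ 0) (r : ℝ≥0∞) (i : Fin n) : toQBall hq r (x i) = QBall.x i :=
  lift_x _ _ i

theorem monomial_mem_range (hq : q ≠ 0) (r : ℝ≥0∞) (k : Fin n →₀ ℕ) :
    QBall.monomial k ∈ (toQBall (n := n) hq r).range := by
  induction k using finsupp_induction_add_single with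
  | h0 => exact one_mem _
  | h1 k i ih =>
    -- The power of `q` undoes the factor `q⁻¹ ^ twist` in the product `x^k x_i`.
    have h : QBall.monomial (k + Finsupp.single i 1) =
        q ^ twist k (Finsupp.single i 1) • (QBall.monomial k * QBall.x i : QBall n q r) := by
      refine Subtype.ext ?_
      change QSeries.monomial (k + Finsupp.single i 1) 1
        = q ^ twist k (Finsupp.single i 1) • (QSeries.monomial k 1 * QSeries.monomial _ 1)
      rw [QSeries.monomial_mul]
      ext l
      rw [QSeries.coeff_smul, QSeries.coeff_monomial, QSeries.coeff_monomial]
      split_ifs <;> simp [hq]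
    rw [h]
    exact Subalgebra.smul_mem _ (mul_mem ih ⟨x i, toQBall_x hq r i⟩) _

theorem denseRange_toQBall (hq : q ≠ 0) (r : ℝ≥0∞) : DenseRange (toQBall (n := n) hq r) := by
  intro a
  refine mem_closure_of_tendsto (QBall.hasSum_monomial a) (Filter.Eventually.of_forall fun s => ?_)
  change _ ∈ (toQBall hq r).range
  exact sum_mem fun k _ => Subalgebra.smul_mem _ (monomial_mem_range hq r k) _

end Aff

theorem ofReal_ne_zero_of_mem (q : Set.Ioo (0 : ℝ) 1) : ((q : ℝ) : ℂ) ≠ 0 :=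
  Complex.ofReal_ne_zero.2 q.2.1.ne'

/-! ### Comparison of the two families of norms -/

namespace Aff

variable {n : ℕ} {q : Set.Ioo (0 : ℝ) 1} {r : ℝ≥0∞}

/-- The operator `π(γ_ρ(a))`. -/
def dilatedRep (ρ : ℝ) : Aff n ((q : ℝ) : ℂ) →ₐ[ℂ] (Fock n →L[ℂ] Fock n) :=
  ((Fock.rep q).toAlgHom.comp Pol.ofAff).comp (gamma ρ)

theorem supNorm_eq (ρ : ℝ) (a : Aff n ((q : ℝ) : ℂ)) : supNorm ρ a = ‖dilatedRep ρ a‖ := rfl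

theorem dilatedRep_x (ρ : ℝ) (i : Fin n) :
    dilatedRep ρ (x i : Aff n ((q : ℝ) : ℂ)) = (ρ : ℂ) • Fock.creation q i := by
  change Fock.rep q (Pol.ofAff (gamma ρ (x i))) = _
  rw [gamma, lift_x, map_smul, map_smul, Pol.ofAff, lift_x]
  congr 1
  exact Pol.lift_x (Fock.rels q) i

/-- Every element is a finite linear combination of the monomials `x^k`. -/
theorem exists_expansion (ρ : ℝ) (a : Aff n ((q : ℝ) : ℂ)) :
    ∃ c : (Fin n →₀ ℕ) →₀ ℂ,
      (∀ k, (toQBall (ofReal_ne_zero_of_mem q) r a).1.coeff k = c k) ∧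
      dilatedRep ρ a = c.sum fun k z => (z * (ρ : ℂ) ^ (∑ i, k i)) • Fock.monomialOp q k := by
  -- Power series and operator are followed simultaneously, so that one family of coefficients
  -- serves both. No linear independence of the monomials in the quantum affine space is needed.
  let F : Aff n ((q : ℝ) : ℂ) →ₐ[ℂ] QSeries n ((q : ℝ) : ℂ) × (Fock n →L[ℂ] Fock n) :=
    ((ballSubalgebra n _ r).val.comp (toQBall (ofReal_ne_zero_of_mem q) r)).prod (dilatedRep ρ)
  let v : (Fin n →₀ ℕ) → QSeries n ((q : ℝ) : ℂ) × (Fock n →L[ℂ] Fock n) := fun k =>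
    (QSeries.monomial k 1, ((ρ : ℂ) ^ (∑ i, k i)) • Fock.monomialOp q k)
  have hv : ∀ i k, F (x i) * v k =
      (((q : ℝ) : ℂ)⁻¹ ^ twist (Finsupp.single i 1) k) • v (Finsupp.single i 1 + k) := by
    intro i k
    refine Prod.ext ?_ ?_
    · change (toQBall (ofReal_ne_zero_of_mem q) r (x i)).1 * QSeries.monomial k 1
        = _ • QSeries.monomial _ 1
      rw [toQBall_x]
      change QSeries.monomial _ 1 * QSeries.monomial k 1 = _
      rw [QSeries.monomial_mul]
      ext l
      rw [QSeries.coeff_smul, QSeries.coeff_monomial, QSeries.coeff_monomial]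
      split_ifs <;> simp
    · change dilatedRep ρ (x i) * (_ • Fock.monomialOp q k) = _ • (_ • Fock.monomialOp q _)
      rw [dilatedRep_x, smul_mul_smul_comm, Fock.creation_mul_monomialOp, smul_smul, smul_smul]
      congr 1
      simp only [Finsupp.add_apply, Finset.sum_add_distrib]
      rw [show ∑ j, (Finsupp.single i 1 : Fin n →₀ ℕ) j = 1 by simp [Finsupp.single_apply], pow_add]
      ring
  -- By `hv` the span of the pairs `v k` is stable under left multiplication by the generators, and
  -- `v 0 = 1`.
  have hmem : F a ∈ Submodule.span ℂ (Set.range v) := by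
    refine map_mem F _ ?_ (fun i m hm => ?_) a
    · refine Submodule.subset_span ⟨0, Prod.ext rfl ?_⟩
      simp [v, Fock.monomialOp_zero]
    · induction hm using Submodule.span_induction with
      | mem m hm =>
        obtain ⟨k, rfl⟩ := hm
        rw [hv]
        exact Submodule.smul_mem _ _ (Submodule.subset_span ⟨_, rfl⟩)
      | zero => rw [mul_zero]; exact Submodule.zero_mem _
      | add m m' _ _ h h' => rw [mul_add]; exact Submodule.add_mem _ h h'
      | smul z m _ h => rw [mul_smul_comm]; exact Submodule.smul_mem _ z h
  obtain ⟨c, hc⟩ := Finsupp.mem_span_range_iff_exists_finsupp.1 hmem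
  have h1 : c.sum (fun k z => z • QSeries.monomial k (1 : ℂ))
      = (toQBall (ofReal_ne_zero_of_mem q) r a).1 := by
    have := congrArg (LinearMap.fst ℂ (QSeries n ((q : ℝ) : ℂ)) (Fock n →L[ℂ] Fock n)) hc
    rwa [map_finsuppSum] at this
  have h2 : c.sum (fun k z => z • (((ρ : ℂ) ^ (∑ i, k i)) • Fock.monomialOp q k))
      = dilatedRep ρ a := by
    have := congrArg (LinearMap.snd ℂ (QSeries n ((q : ℝ) : ℂ)) (Fock n →L[ℂ] Fock n)) hc
    rwa [map_finsuppSum] at this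
  refine ⟨c, fun k => ?_, by simpa only [smul_smul] using h2.symm⟩
  rw [← h1]
  have h3 : ∀ s : Finset (Fin n →₀ ℕ), QSeries.coeff (∑ l ∈ s, c l • QSeries.monomial l (1 : ℂ) :
      QSeries n ((q : ℝ) : ℂ)) k = ∑ l ∈ s, if k = l then c l else 0 := by
    intro s
    refine (Finset.sum_apply (M := fun _ => ℂ) k s
      (fun l => (c l • QSeries.monomial l (1 : ℂ) : QSeries n ((q : ℝ) : ℂ)))).trans ?_
    refine Finset.sum_congr rfl fun l _ => ?_
    change QSeries.coeff (c l • QSeries.monomial l (1 : ℂ) : QSeries n ((q : ℝ) : ℂ)) k = _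
    rw [QSeries.coeff_smul, QSeries.coeff_monomial]
    split_ifs <;> simp
  rw [Finsupp.sum, h3]
  simp +contextual [eq_comm]

/-- The triangle inequality over monomials, with the operator norm of each `x^k` bounded by its
weight. Neither the constant nor the radius has to change with `ρ`. -/
theorem exists_supNorm_le (n : ℕ) (q : Set.Ioo (0 : ℝ) 1) (r : ℝ≥0∞) :
    ∃ C : ℝ, 0 < C ∧ ∀ (ρ : Radius r) (a : Aff n ((q : ℝ) : ℂ)),
      supNorm ρ.1 a ≤ C * QBall.norm ρ (toQBall (ofReal_ne_zero_of_mem q) r a) := by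
  obtain ⟨C, hC, h⟩ := Fock.exists_pow_twist_le (n := n) q
  refine ⟨C, hC, fun ρ a => ?_⟩
  have hρ := ρ.2.1
  obtain ⟨c, hc, ha⟩ := exists_expansion (r := r) ρ.1 a
  rw [supNorm_eq, ha, QBall.norm_apply, ← tsum_mul_left]
  calc _ ≤ ∑ k ∈ c.support, ‖(c k * (ρ.1 : ℂ) ^ (∑ i, k i)) • Fock.monomialOp q k‖ :=
        norm_sum_le _ _
    _ ≤ ∑ k ∈ c.support,
        C * QSeries.normTerm ρ.1 (toQBall (ofReal_ne_zero_of_mem q) r a).1 k := by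
        refine Finset.sum_le_sum fun k _ => ?_
        rw [norm_smul, norm_mul, norm_pow, Complex.norm_real, Real.norm_of_nonneg hρ.le,
          QSeries.normTerm, hc]
        calc _ ≤ ‖c k‖ * ρ.1 ^ (∑ i, k i) * (C * ballWeight ((q : ℝ) : ℂ) k) := by
              gcongr
              exact (Fock.norm_monomialOp_le q k).trans (h k)
          _ = _ := by ring
    _ ≤ _ := (((toQBall (ofReal_ne_zero_of_mem q) r a).2 ρ).mul_left C).sum_le_tsum _
        fun k _ => mul_nonneg hC.le (QSeries.normTerm_nonneg hρ _ k)

/-- A Cauchy estimate: the left side is the modulus of the `e_k`-coordinate of the image of the unit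
vector `e 0`. -/
theorem norm_coeff_le (ρ : Radius r) (a : Aff n ((q : ℝ) : ℂ)) (k : Fin n →₀ ℕ) :
    ‖(toQBall (ofReal_ne_zero_of_mem q) r a).1.coeff k‖ * Fock.monomialCoef q k 0
      * ρ.1 ^ (∑ i, k i) ≤ supNorm ρ.1 a := by
  have hρ := ρ.2.1
  obtain ⟨c, hc, ha⟩ := exists_expansion (r := r) ρ.1 a
  have h1 : dilatedRep ρ.1 a (Fock.e 0) k
      = c k * (ρ.1 : ℂ) ^ (∑ i, k i) * (Fock.monomialCoef q k 0 : ℂ) := by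
    rw [ha, Finsupp.sum, sum_apply, lp.coeFn_sum, Finset.sum_apply]
    calc _ = ∑ l ∈ c.support, c l * (ρ.1 : ℂ) ^ (∑ i, l i) *
          (if k = l then (Fock.monomialCoef q l 0 : ℂ) else 0) := by
          refine Finset.sum_congr rfl fun l _ => ?_
          rw [← Fock.monomialOp_e_zero]
          rfl
      _ = _ := by simp +contextual
  calc _ = ‖dilatedRep ρ.1 a (Fock.e 0) k‖ := by
        rw [h1, norm_mul, norm_mul, norm_pow, Complex.norm_real, Complex.norm_real,
          Real.norm_of_nonneg hρ.le, Real.norm_of_nonneg (Fock.monomialCoef_pos q k 0).le, hc]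
        ring
    _ ≤ ‖dilatedRep ρ.1 a (Fock.e 0)‖ := lp.norm_apply_le_norm two_ne_zero _ _
    _ ≤ ‖dilatedRep ρ.1 a‖ * ‖(Fock.e 0 : Fock n)‖ := ContinuousLinearMap.le_opNorm _ _
    _ = supNorm ρ.1 a := by
        rw [Fock.e, lp.norm_single (by norm_num), norm_one, mul_one, supNorm_eq]

/-- Cauchy estimates at a larger radius `σ` bound the terms at `ρ` by a multiple of `(ρ/σ)^|k|`,
which is summable. The room for `σ` comes from the strict inequality `ρ < r`. -/
theorem exists_norm_toQBall_le (ρ : Radius r) : ∃ (σ : Radius r) (C : ℝ), 0 < C ∧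
    ∀ a : Aff n ((q : ℝ) : ℂ),
      QBall.norm ρ (toQBall (ofReal_ne_zero_of_mem q) r a) ≤ C * supNorm σ.1 a := by
  obtain ⟨σ, hσ⟩ := ρ.exists_gt
  obtain ⟨C, hC, h⟩ := Fock.exists_ballWeight_le (n := n) q
  have hρ0 := ρ.2.1
  have hσ0 := σ.2.1
  have ht := summable_pow_sum (ι := Fin n) (t := ρ.1 / σ.1) (by positivity) ((div_lt_one hσ0).2 hσ)
  have hpos : 0 < ∑' k : Fin n →₀ ℕ, (ρ.1 / σ.1) ^ (∑ i, k i) :=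
    ht.tsum_pos (fun _ => by positivity) 0 (by positivity)
  refine ⟨σ, C * ∑' k : Fin n →₀ ℕ, (ρ.1 / σ.1) ^ (∑ i, k i), by positivity, fun a => ?_⟩
  rw [QBall.norm_apply, mul_assoc, ← tsum_mul_right, ← tsum_mul_left]
  refine Summable.tsum_le_tsum (fun k => ?_) ((toQBall (ofReal_ne_zero_of_mem q) r a).2 ρ)
    ((ht.mul_right _).mul_left C)
  have h1 := norm_coeff_le σ a k
  set z := ‖(toQBall (ofReal_ne_zero_of_mem q) r a).1.coeff k‖ with hz
  calc QSeries.normTerm ρ.1 _ k ≤ z * (C * Fock.monomialCoef q k 0) * ρ.1 ^ (∑ i, k i) := by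
        unfold QSeries.normTerm
        gcongr
        exact h k
    _ = C * ((ρ.1 / σ.1) ^ (∑ i, k i) *
        (z * Fock.monomialCoef q k 0 * σ.1 ^ (∑ i, k i))) := by
        rw [div_pow]; field_simp
    _ ≤ _ := by gcongr

end Aff

/-! ### The ball algebra as a completion -/

namespace AffSup

variable {n : ℕ} {q : Set.Ioo (0 : ℝ) 1} {r : ℝ≥0∞}

/-- The inclusion of the quantum affine space into the functions on the quantum ball. -/
def toQBall : AffSup n q r →ₐ[ℂ] QBall n ((q : ℝ) : ℂ) r :=
  Aff.toQBall (ofReal_ne_zero_of_mem q) r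

theorem toQBall_x (i : Fin n) : toQBall (x i : AffSup n q r) = QBall.x i :=
  Aff.toQBall_x _ r i

theorem withSeminorms : WithSeminorms (norm (n := n) (q := q) (r := r)) :=
  (SeminormFamily.withSeminorms_iff_uniformSpace_eq_iInf _).2 rfl

/-- The operator norms and the pulled-back ball norms dominate each other, so they define the same
topology; each norm is controlled by a single norm of the other family. -/
theorem isInducing_toQBall : Topology.IsInducing (toQBall (n := n) (q := q) (r := r)) := by
  have h := LinearMap.withSeminorms_induced QBall.withSeminorms
    (toQBall (n := n) (q := q) (r := r)).toLinearMap
  refine ⟨?_⟩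
  refine (WithSeminorms.topology_eq_withSeminorms
    ((withSeminorms (n := n) (q := q) (r := r)).congr ?_ ?_)).trans
      (@WithSeminorms.topology_eq_withSeminorms _ _ _ _ _ _ _ (_) h).symm
  · intro ρ
    obtain ⟨σ, C, hC, hle⟩ := Aff.exists_norm_toQBall_le (n := n) (q := q) ρ
    refine ⟨{σ}, ⟨C, hC.le⟩, fun a => ?_⟩
    rw [Finset.sup_singleton]
    exact hle a
  · intro ρ
    obtain ⟨C, hC, hle⟩ := Aff.exists_supNorm_le n q r
    refine ⟨{ρ}, ⟨C, hC.le⟩, fun a => ?_⟩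
    rw [Finset.sup_singleton]
    exact hle ρ a

theorem isUniformInducing_toQBall : IsUniformInducing (toQBall (n := n) (q := q) (r := r)) :=
  AddMonoidHom.isUniformInducing_of_isInducing isInducing_toQBall

/-- The algebra `O_q(𝔹ⁿ_r)` as a completion of the quantum affine space. -/
def qBallCompletion (n : ℕ) (q : Set.Ioo (0 : ℝ) 1) {r : ℝ≥0∞} (hr : 0 < r) :
    AbstractCompletion (AffSup n q r) where
  space := QBall n ((q : ℝ) : ℂ) r
  coe := toQBall
  uniformStruct := inferInstance
  complete := QBall.completeSpace hr
  separation := have := QBall.t2Space (n := n) (q := ((q : ℝ) : ℂ)) hr; inferInstance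
  isUniformInducing := isUniformInducing_toQBall
  dense := Aff.denseRange_toQBall _ r

end AffSup

/-! ### The isomorphism of topological algebras -/

namespace AffCompletion

variable {n : ℕ} {q : Set.Ioo (0 : ℝ) 1} {r : ℝ≥0∞}

/-- The comparison of the two completions of the quantum affine space. -/
def uniformEquivQBall (n : ℕ) (q : Set.Ioo (0 : ℝ) 1) {r : ℝ≥0∞} (hr : 0 < r) :
    AffCompletion n q r ≃ᵤ QBall n ((q : ℝ) : ℂ) r :=
  UniformSpace.Completion.cPkg.compareEquiv (AffSup.qBallCompletion n q hr)

theorem uniformEquivQBall_coe (hr : 0 < r) (a : AffSup n q r) :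
    uniformEquivQBall n q hr (a : AffCompletion n q r) = AffSup.toQBall a :=
  AbstractCompletion.compare_coe UniformSpace.Completion.cPkg (AffSup.qBallCompletion n q hr) a

theorem uniformEquivQBall_add (hr : 0 < r) (a b : AffCompletion n q r) :
    uniformEquivQBall n q hr (a + b) = uniformEquivQBall n q hr a + uniformEquivQBall n q hr b := by
  have := QBall.t2Space (n := n) (q := ((q : ℝ) : ℂ)) hr
  have hΦ := (uniformEquivQBall n q hr).continuous
  induction a, b using UniformSpace.Completion.induction_on₂ with
  | hp => exact isClosed_eq (by fun_prop) (by fun_prop)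
  | ih a b =>
    rw [← UniformSpace.Completion.coe_add]
    simp only [uniformEquivQBall_coe, map_add]

/-- Density of the polynomials reduces the claim to `AffSup.toQBall`. Continuity of multiplication
is used only on the completion: on the ball side each coefficient of a product is a finite sum of
products of coefficients of the factors, and these are continuous. -/
theorem uniformEquivQBall_mul (hr : 0 < r) (a b : AffCompletion n q r) :
    uniformEquivQBall n q hr (a * b) = uniformEquivQBall n q hr a * uniformEquivQBall n q hr b := by
  have hΦ := (uniformEquivQBall n q hr).continuous
  refine Subtype.ext (QSeries.ext fun k => ?_)
  have hc := fun l => QBall.continuous_coeff (n := n) (q := ((q : ℝ) : ℂ)) hr l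
  change _ = ((uniformEquivQBall n q hr a).1 * (uniformEquivQBall n q hr b).1).coeff k
  rw [QSeries.coeff_mul]
  induction a, b using UniformSpace.Completion.induction_on₂ with
  | hp =>
    refine isClosed_eq ((hc k).comp (hΦ.comp continuous_mul)) (continuous_finsetSum _ fun l _ => ?_)
    exact continuous_const.mul (((hc l.1).comp (hΦ.comp continuous_fst)).mul
      ((hc l.2).comp (hΦ.comp continuous_snd)))
  | ih a b =>
    rw [← UniformSpace.Completion.coe_mul, ← QSeries.coeff_mul]
    simp only [uniformEquivQBall_coe, map_mul]
    rfl

/-- The isomorphism of the completion with `O_q(𝔹ⁿ_r)`. -/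
def equivQBall (n : ℕ) (q : Set.Ioo (0 : ℝ) 1) {r : ℝ≥0∞} (hr : 0 < r) :
    AffCompletion n q r ≃A[ℂ] QBall n ((q : ℝ) : ℂ) r where
  toEquiv := (uniformEquivQBall n q hr).toEquiv
  map_mul' := uniformEquivQBall_mul hr
  map_add' := uniformEquivQBall_add hr
  commutes' c := by
    -- Scalars of the completion are by definition the images of scalars of the quantum affine
    -- space.
    change uniformEquivQBall n q hr ((algebraMap ℂ (AffSup n q r) c : AffSup n q r)) = _
    rw [uniformEquivQBall_coe, AlgHom.commutes]
  continuous_toFun := (uniformEquivQBall n q hr).continuous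
  continuous_invFun := (uniformEquivQBall n q hr).symm.continuous

end AffCompletion

end QuantumBall

end

theorem mainTheorem2 (n : ℕ) (q : Set.Ioo (0 : ℝ) 1) (r : ℝ≥0∞) (hr : 0 < r) :
    ∃ Φ : QuantumBall.AffCompletion n q r ≃A[ℂ] QuantumBall.QBall n ((q : ℝ) : ℂ) r,
      ∀ i : Fin n, Φ ((QuantumBall.AffSup.x i : QuantumBall.AffSup n q r) :
        QuantumBall.AffCompletion n q r) = QuantumBall.QBall.x i := by
  refine ⟨QuantumBall.AffCompletion.equivQBall n q hr, fun i => ?_⟩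
  exact (QuantumBall.AffCompletion.uniformEquivQBall_coe hr _).trans
    (QuantumBall.AffSup.toQBall_x i)
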